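/- An instance of the Hamiltonian cycle problem is a finite loopless directed graph $\Gamma$ (an undirected edge counts as a pair of opposite directed edges); it is Hamiltonian if its $N$ vertices can be arranged cyclically as $v_0\to v_1\to\dots\to v_{N-1}\to v_0$. Let $e$ be its number of directed edges and $k=\sum_v\max(\deg^{\rm in}v,\deg^{\rm out}v)$. Below, "replacing a vertex $v$ by a subgraph" means that every edge incident with $v$ is kept, with its direction (if any) and its other end, and becomes an external edge at a specified vertex of the subgraph. * A *split* has vertices $1,2$ and the directed edge $(1,2)$; incoming external edges are at $1$, outgoing ones at $2$. An *in-split* has vertices $1,2,3$ and directed edges $(1,2),(1,3),(2,1),(2,3)$; incoming external edges are shared by $1$ and $2$ in numbers differing by at most one, outgoing ones are at $3$. An *out-split* has vertices $1,2,3$ and directed edges $(1,2),(1,3),(2,3),(3,2)$; incoming external edges are at $1$, outgoing ones are shared by $2$ and $3$ in numbers differing by at most one. * For $s\ge4$, the *$s$-gate* is the undirected graph with vertices $1,\dots,10$ and $b_1,\dots,b_{2s-7}$, with edges $\{1,3\},\{1,8\},\{2,3\},\{2,5\},\{3,4\},\{4,5\},\{4,6\},\{6,7\},\{7,8\},\{7,10\},\{8,9\},\{9,10\}$,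 $\{b_j,b_{j+1}\}$ for $1\le j<2s-7$, $\{5,b_1\}$, $\{10,b_{2s-7}\}$, and $\{1,b_j\}$ for even $j$. It has one external edge at each of $1,2,9$ and $b_j$, $j$ odd. When some of the external edges are directed ($s'$ incoming, $r'$ outgoing) it serves as an *$(s',r')$-gate*. * A *diamond* is $K_4$ minus one edge, with one external edge at each of its two vertices of degree $2$. The *conversion procedure* with parameter $d\ge4$ is as follows. 1. While some vertex $v$ has in-degree or out-degree greater than $d$, perform the Splitting Procedure on it: replace $v$ by a split; while a vertex of the subgraph replacing $v$ has in-degree $>d$, replace it by an in-split; then, while a vertex of that subgraph has out-degree $>d$, replace it by an out-split. 2. While some vertex is incident with $s\ge4$ edges (incoming, outgoing and undirected edges counted together), replace it by an $s$-gate whose external edges are, in any order, these $s$ edges. 3. Make the graph undirected (Karp): each vertex $i$ becomes a path $i_1-i_2-i_3$, and each directed edge $(i,j)$ becomes the undirected edge $\{i_3,j_1\}$, an undirected edge counting as two directed ones. 4. While some vertex has degree $4$, replace it by a $4$-gate. 5. If some vertex has degree at most $1$, replace the whole graph by the Petersen graph; otherwise, while some vertex has degree $2$, replace it by a diamond. **Theorem.**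 For every integer $d\ge4$, none of the loops in this procedure can run forever, and there is a constant $C$, depending only on $d$, such that for every instance $\Gamma$ with $N$ vertices the procedure has an outcome, and, whatever choices are made, every outcome $\Gamma'$ is an undirected cubic graph such that * $\Gamma'$ is Hamiltonian if and only if $\Gamma$ is; * if $k\ge1$, then $\Gamma'$ has at most $Ck$ vertices and at most $Ck$ edges; * the numbers of vertices and edges of $\Gamma'$ add up to at most $C(N+e)$, i.e. the conversion is linearly-growing. -/

import Mathlib

/-! ## Instances of the (general, directed) Hamiltonian cycle problem -/

/-- A directed graph on a finite vertex set has a Hamiltonian cycle: its vertices can be arranged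
cyclically as `v₀ → v₁ → ⋯ → v_{N-1} → v₀`. (A loopless digraph with fewer than two vertices has
none; on two vertices the pair `u → v → u` is one.) -/
def HasDirectedHamiltonianCycle {V : Type} (G : Digraph V) : Prop :=
  ∃ f : ZMod (Nat.card V) ≃ V, ∀ i, G.Adj (f i) (f (i + 1))

/-- The number `k`: the sum over all vertices of the larger of in-degree and out-degree. -/
noncomputable def sumMaxDegree {V : Type} (G : Digraph V) : ℕ :=
  ∑ᶠ v : V, max {u | G.Adj u v}.ncard {w | G.Adj v w}.ncard

/-- The number of (directed) edges. -/
noncomputable def numArcs {V : Type} (G : Digraph V) : ℕ :=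
  {x : V × V | G.Adj x.1 x.2}.ncard

/-! ## Mixed graphs and the replacement of a vertex by a subgraph -/

/-- A finite graph with directed edges (`Arc`) and undirected edges (`edge`), without loops. -/
structure MixedGraph where
  V : Type
  finite : Finite V
  Arc : V → V → Prop
  arc_irrefl : ∀ v, ¬ Arc v v
  edge : SimpleGraph V

/-- The ways in which an edge may be incident with a given vertex: incoming, outgoing, or
undirected. -/
inductive Kind
  | inc
  | out
  | und

namespace MixedGraph

instance (M : MixedGraph) : Finite M.V := M.finite

/-- A loopless directed graph, all of whose edges are directed. -/
def ofDigraph {V : Type} [Finite V] (G : Digraph V) (hG : ∀ v, ¬ G.Adj v v) : MixedGraph where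
  V := V
  finite := inferInstance
  Arc := G.Adj
  arc_irrefl := hG
  edge := ⊥

/-- An undirected graph. -/
def ofSimpleGraph {V : Type} [Finite V] (G : SimpleGraph V) : MixedGraph where
  V := V
  finite := inferInstance
  Arc _ _ := False
  arc_irrefl _ := id
  edge := G

noncomputable def inDegree (M : MixedGraph) (v : M.V) : ℕ := {u | M.Arc u v}.ncard

noncomputable def outDegree (M : MixedGraph) (v : M.V) : ℕ := {w | M.Arc v w}.ncard

/-- The edges incident with `v`, each given by its kind and its other end. -/
def incident (M : MixedGraph) (v : M.V) : Set (Kind × M.V) :=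
  {x | match x with
    | (Kind.inc, u) => M.Arc u v
    | (Kind.out, w) => M.Arc v w
    | (Kind.und, w) => M.edge.Adj v w}

/-- The number of edges incident with `v`: incoming, outgoing, and undirected ones. -/
noncomputable def degree (M : MixedGraph) (v : M.V) : ℕ := (M.incident v).ncard

/-- Replace the vertex `v` by the graph `H`. Every edge that was incident with `v` is kept, with
its kind and its other end; its end `v` becomes the vertex of `H` that `p` assigns to the edge. -/
def replace (M : MixedGraph) (v : M.V) (H : MixedGraph) (p : Kind × M.V → H.V) : MixedGraph where
  V := {w : M.V // w ≠ v} ⊕ H.V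
  finite := inferInstance
  Arc x y :=
    match x, y with
    | .inl a, .inl b => M.Arc a b
    | .inl a, .inr h => M.Arc a v ∧ p (Kind.inc, a) = h
    | .inr h, .inl b => M.Arc v b ∧ p (Kind.out, b) = h
    | .inr h, .inr h' => H.Arc h h'
  arc_irrefl x := by
    rcases x with a | h
    · exact M.arc_irrefl a
    · exact H.arc_irrefl h
  edge :=
    { Adj := fun x y =>
        match x, y with
        | .inl a, .inl b => M.edge.Adj a b
        | .inl a, .inr h => M.edge.Adj v a ∧ p (Kind.und, a) = h
        | .inr h, .inl b => M.edge.Adj v b ∧ p (Kind.und, b) = h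
        | .inr h, .inr h' => H.edge.Adj h h'
      symm := ⟨by
        rintro (a | h) (b | h') hxy
        · exact M.edge.adj_symm hxy
        · exact hxy
        · exact hxy
        · exact H.edge.adj_symm hxy⟩
      loopless := ⟨by
        rintro (a | h) hx
        · exact M.edge.loopless.irrefl _ hx
        · exact H.edge.loopless.irrefl _ hx⟩ }

end MixedGraph

/-- `RunLoop step a b`: starting from `a`, steps are performed, with arbitrary choices, as long as
possible, and the result is `b`. -/
def RunLoop {α : Type*} (step : α → α → Prop) (a b : α) : Prop :=
  Relation.ReflTransGen step a b ∧ ∀ c, ¬ step b c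

/-- There is no infinite sequence of steps. -/
def LoopTerminates {α : Type*} (step : α → α → Prop) : Prop :=
  WellFounded fun b a => step a b

namespace HCP

open MixedGraph

/-! ## The Splitting Procedure -/

/-- A split: vertices `1, 2` (here `0, 1`) and the directed edge `(1,2)`. -/
def split : MixedGraph where
  V := Fin 2
  finite := inferInstance
  Arc a b := (a, b) = (0, 1)
  arc_irrefl := by decide
  edge := ⊥

/-- An in-split: vertices `1, 2, 3` (here `0, 1, 2`) and the directed edges
`(1,2), (1,3), (2,1), (2,3)`. -/
def inSplit : MixedGraph where
  V := Fin 3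
  finite := inferInstance
  Arc a b := (a, b) ∈ ([(0, 1), (0, 2), (1, 0), (1, 2)] : List (Fin 3 × Fin 3))
  arc_irrefl := by decide
  edge := ⊥

/-- An out-split: vertices `1, 2, 3` (here `0, 1, 2`) and the directed edges
`(1,2), (1,3), (2,3), (3,2)`. -/
def outSplit : MixedGraph where
  V := Fin 3
  finite := inferInstance
  Arc a b := (a, b) ∈ ([(0, 1), (0, 2), (1, 2), (2, 1)] : List (Fin 3 × Fin 3))
  arc_irrefl := by decide
  edge := ⊥

/-- A graph in which a subgraph, given by its vertex set, is singled out: in the Splitting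
Procedure, the subgraph that has replaced the vertex under consideration. -/
structure Marked where
  graph : MixedGraph
  part : Set graph.V

/-- Replace a vertex by a subgraph, all of whose vertices belong to the marked part. -/
def Marked.replace (A : Marked) (v : A.graph.V) (H : MixedGraph)
    (p : Kind × A.graph.V → H.V) : Marked where
  graph := A.graph.replace v H p
  part := {x | match x with
    | .inl w => w.1 ∈ A.part
    | .inr _ => True}

/-- Replace `v` by a split: incoming edges go to vertex `1`, outgoing edges leave from `2`. -/
def InitialSplit (M : MixedGraph) (v : M.V) (B : Marked) : Prop :=
  ∃ p : Kind × M.V → Fin 2,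
    (∀ u, M.Arc u v → p (Kind.inc, u) = 0) ∧
    (∀ w, M.Arc v w → p (Kind.out, w) = 1) ∧
    B = Marked.replace ⟨M, ∅⟩ v split p

/-- Replace a vertex of the marked part with in-degree greater than `d` by an in-split: its incoming
edges are shared as equally as possible by vertices `1` and `2`, its outgoing edges leave from
`3`. -/
def InSplitStep (d : ℕ) (A B : Marked) : Prop :=
  ∃ v ∈ A.part, ∃ p : Kind × A.graph.V → Fin 3,
    d < A.graph.inDegree v ∧
    (∀ u, A.graph.Arc u v → p (Kind.inc, u) = 0 ∨ p (Kind.inc, u) = 1) ∧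
    {u | A.graph.Arc u v ∧ p (Kind.inc, u) = 0}.ncard ≤
      {u | A.graph.Arc u v ∧ p (Kind.inc, u) = 1}.ncard + 1 ∧
    {u | A.graph.Arc u v ∧ p (Kind.inc, u) = 1}.ncard ≤
      {u | A.graph.Arc u v ∧ p (Kind.inc, u) = 0}.ncard + 1 ∧
    (∀ w, A.graph.Arc v w → p (Kind.out, w) = 2) ∧
    B = A.replace v inSplit p

/-- Replace a vertex of the marked part with out-degree greater than `d` by an out-split: its
incoming edges go to vertex `1`, its outgoing edges are shared as equally as possible by vertices
`2` and `3`. -/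
def OutSplitStep (d : ℕ) (A B : Marked) : Prop :=
  ∃ v ∈ A.part, ∃ p : Kind × A.graph.V → Fin 3,
    d < A.graph.outDegree v ∧
    (∀ u, A.graph.Arc u v → p (Kind.inc, u) = 0) ∧
    (∀ w, A.graph.Arc v w → p (Kind.out, w) = 1 ∨ p (Kind.out, w) = 2) ∧
    {w | A.graph.Arc v w ∧ p (Kind.out, w) = 1}.ncard ≤
      {w | A.graph.Arc v w ∧ p (Kind.out, w) = 2}.ncard + 1 ∧
    {w | A.graph.Arc v w ∧ p (Kind.out, w) = 2}.ncard ≤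
      {w | A.graph.Arc v w ∧ p (Kind.out, w) = 1}.ncard + 1 ∧
    B = A.replace v outSplit p

/-- The Splitting Procedure at the vertex `v`: replace `v` by a split; while a vertex of the
subgraph has in-degree greater than `d`, replace it by an in-split; then, while a vertex of the
subgraph has out-degree greater than `d`, replace it by an out-split. -/
def SplittingProcedure (d : ℕ) (M : MixedGraph) (v : M.V) (M' : MixedGraph) : Prop :=
  ∃ A B C : Marked, InitialSplit M v A ∧
    RunLoop (InSplitStep d) A B ∧ RunLoop (OutSplitStep d) B C ∧ M' = C.graph

/-- Perform the Splitting Procedure on a vertex with in-degree or out-degree greater than `d`. -/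
def SplitStep (d : ℕ) (M M' : MixedGraph) : Prop :=
  ∃ v, (d < M.inDegree v ∨ d < M.outDegree v) ∧ SplittingProcedure d M v M'

/-! ## Gates -/

/-- One orientation of each edge of the `s`-gate (`s ≥ 4`). The vertices `.inl 0, …, .inl 9` carry
the labels `1, …, 10`; the vertices `.inr j` form the bottom row, a path of `2s - 7` vertices
which is joined to the vertices `5` and `10` at its two ends; every second vertex of the bottom row,
starting from its second one, is adjacent to the top vertex `1`. -/
def gateRel (s : ℕ) : Fin 10 ⊕ Fin (2 * s - 7) → Fin 10 ⊕ Fin (2 * s - 7) → Prop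
  | .inl a, .inl b => (a.val + 1, b.val + 1) ∈
      ([(1, 3), (1, 8), (2, 3), (2, 5), (3, 4), (4, 5), (4, 6), (6, 7), (7, 8), (7, 10), (8, 9),
        (9, 10)] : List (ℕ × ℕ))
  | .inl a, .inr j => (a.val + 1 = 5 ∧ j.val = 0) ∨ (a.val + 1 = 10 ∧ j.val + 1 = 2 * s - 7) ∨
      (a.val + 1 = 1 ∧ Odd j.val)
  | .inr j, .inr j' => j.val + 1 = j'.val
  | .inr _, .inl _ => False

/-- The `s`-gate, an undirected graph. -/
def gate (s : ℕ) : MixedGraph := ofSimpleGraph (SimpleGraph.fromRel (gateRel s))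

/-- The `s` vertices of the `s`-gate at which it has an external edge: the top vertex `1`, the left
vertex `2`, the right vertex `9`, and every second vertex of the bottom row, starting from its
first one. -/
def gateExternal (s : ℕ) : Set (gate s).V :=
  {x : Fin 10 ⊕ Fin (2 * s - 7) | match x with
    | .inl a => a.val + 1 = 1 ∨ a.val + 1 = 2 ∨ a.val + 1 = 9
    | .inr j => Even j.val}

/-- Replace a vertex with `s ≥ 4` incident edges by an `s`-gate, whose external edges are, in some
order, the edges that were incident with the vertex. If these are `s'` incoming and `r'` outgoing
edges, the subgraph is an `(s', r')`-gate. -/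
def GateStep (M M' : MixedGraph) : Prop :=
  ∃ (v : M.V) (p : Kind × M.V → (gate (M.degree v)).V),
    4 ≤ M.degree v ∧ Set.BijOn p (M.incident v) (gateExternal (M.degree v)) ∧
    M' = M.replace v (gate (M.degree v)) p

/-- Replace a vertex of degree `4` by a `4`-gate. -/
def FourGateStep (M M' : MixedGraph) : Prop :=
  ∃ (v : M.V) (p : Kind × M.V → (gate 4).V),
    M.degree v = 4 ∧ Set.BijOn p (M.incident v) (gateExternal 4) ∧
    M' = M.replace v (gate 4) p

/-! ## From directed to undirected graphs -/

/-- Karp's conversion. Each vertex `i` becomes a path `(i,0) - (i,1) - (i,2)`, and each directed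
edge from `i` to `j` becomes the undirected edge between `(i,2)` and `(j,0)`. An undirected edge of
the given graph counts as two directed edges. -/
def karp (M : MixedGraph) : MixedGraph :=
  ofSimpleGraph (V := M.V × Fin 3) <| SimpleGraph.fromRel fun x y =>
    (x.1 = y.1 ∧ x.2 = 1 ∧ (y.2 = 0 ∨ y.2 = 2)) ∨
    ((M.Arc x.1 y.1 ∨ M.edge.Adj x.1 y.1) ∧ x.2 = 2 ∧ y.2 = 0)

/-! ## From sub-cubic to cubic graphs -/

/-- The diamond: the complete graph on four vertices without the edge between `0` and `3`. -/
def diamond : MixedGraph :=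
  ofSimpleGraph (SimpleGraph.fromEdgeSet
    {s(0, 1), s(0, 2), s(1, 2), s(1, 3), s((2 : Fin 4), 3)})

/-- Replace a vertex of degree `2` by a diamond, whose external edges are attached to its two
vertices of degree `2`. -/
def DiamondStep (M M' : MixedGraph) : Prop :=
  ∃ (v : M.V) (p : Kind × M.V → Fin 4),
    M.degree v = 2 ∧ Set.BijOn p (M.incident v) {0, 3} ∧ M' = M.replace v diamond p

/-- The Petersen graph: an outer 5-cycle, five spokes, and an inner pentagram. -/
def petersen : MixedGraph :=
  ofSimpleGraph (V := Fin 5 × Bool) <| SimpleGraph.fromRel fun x y =>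
    (x.2 = false ∧ y.2 = false ∧ y.1 = x.1 + 1) ∨
    (x.2 = false ∧ y.2 = true ∧ y.1 = x.1) ∨
    (x.2 = true ∧ y.2 = true ∧ y.1 = x.1 + 2)

/-- A graph with a vertex of degree at most `1` is replaced by the Petersen graph; otherwise all
vertices of degree `2` are replaced by diamonds. -/
def SubcubicToCubic (M H : MixedGraph) : Prop :=
  ((∃ v, M.degree v ≤ 1) ∧ H = petersen) ∨
  ((¬ ∃ v, M.degree v ≤ 1) ∧ RunLoop DiamondStep M H)

/-! ## The conversion -/

/-- `Conversion d M H`: the graph `H` is a possible outcome of the procedure that converts `M` to a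
cubic instance, with the bound `d` for the Splitting Procedure: first the Splitting Procedure is
performed on vertices with in-degree or out-degree greater than `d`, as long as there are any; then
vertices with at least `4` incident edges are replaced by gates, as long as there are any; then the
graph is made undirected; then vertices of degree `4` are replaced by `4`-gates, as long as there
are any; finally the sub-cubic graph is made cubic. -/
def Conversion (d : ℕ) (M H : MixedGraph) : Prop :=
  ∃ A B D : MixedGraph, RunLoop (SplitStep d) M A ∧ RunLoop GateStep A B ∧
    RunLoop FourGateStep (karp B) D ∧ SubcubicToCubic D H

/-- The graph is undirected and cubic. -/
def IsUndirectedCubic (H : MixedGraph) : Prop :=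
  (∀ x y, ¬ H.Arc x y) ∧ ∀ v, (H.edge.neighborSet v).ncard = 3

/-- The undirected graph formed by the undirected edges is Hamiltonian. -/
def HasHamiltonianCycle (H : MixedGraph) : Prop :=
  @SimpleGraph.IsHamiltonian H.V (Classical.decEq H.V) (Fintype.ofFinite H.V) H.edge

end HCP

/-!
A tour is encoded by the map sending each vertex to its successor, which is a single cycle. Let
`v` be replaced by a gadget. If a Hamiltonian cycle of the new graph passes through the gadget
exactly once, contracting the gadget gives a Hamiltonian cycle of the old graph; conversely, the
gadget has a Hamiltonian path between any two external vertices which the old cycle may have to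
connect. That there is only one passage is seen by summing a weight along the cycle: its sum over
the gadget is `1`, and so is its sum over every passage. For the splits, this is the indicator of
a single vertex through which every passage goes; for a gate it is `1` on one colour class and
`-1` on the other of a proper `2`-colouring, whose larger class has one vertex more and carries
all external edges.

In Karp's graph the middle vertex of a path has degree `2`, so every path is traversed as a whole,
and all paths in the same direction. A graph with a vertex of degree at most `1` is not
Hamiltonian, and neither is the Petersen graph; an isolated vertex, which `k` does not count,
survives until it turns the whole graph into the Petersen graph. The size is controlled by sums
over all vertices of functions of their degrees, which do not increase under replacements.
-/

open Relation

/-! ### Tours -/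

section Tours

variable {V V' : Type*} {R : V → V → Prop} {f : V → V} {a b : V}

/-- The map `f` runs through all of `V` in a single cycle, when `V` is finite: every element can be
reached from every other one by iterating `f`. -/
def IsSingleCycle (f : V → V) : Prop :=
  ∀ x y, ReflTransGen (fun a b => f a = b) x y

/-- A Hamiltonian cycle of the relation `R`, encoded by the map that sends every element to its
successor. -/
def HasTour (R : V → V → Prop) : Prop :=
  Nonempty V ∧ ∃ f : V → V, IsSingleCycle f ∧ ∀ x, R x (f x)

/-- A Hamiltonian path from `a` to `b` of the relation `R`, encoded by the map that sends every
element to its successor and `b` back to `a`. -/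
def HasTraversal (R : V → V → Prop) (a b : V) : Prop :=
  ∃ f : V → V, IsSingleCycle f ∧ f b = a ∧ ∀ x ≠ b, R x (f x)

theorem IsSingleCycle.surjective (hf : IsSingleCycle f) : f.Surjective := fun y => by
  rcases (hf (f y) y).cases_tail with hy | ⟨x, -, hx⟩
  exacts [⟨y, hy.symm⟩, ⟨x, hx⟩]

theorem IsSingleCycle.bijective [Finite V] (hf : IsSingleCycle f) : f.Bijective :=
  hf.surjective.bijective_of_finite

theorem IsSingleCycle.of_rightInverse {g : V → V} (hf : IsSingleCycle f)
    (hg : Function.RightInverse f g) : IsSingleCycle g := fun x y =>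
  (reflTransGen_swap.2 (hf y x)).lift' id fun a b (h : f b = a) => .single (h ▸ hg b)

theorem isSingleCycle_iff_isCycleOn [Finite V] {σ : Equiv.Perm V} :
    IsSingleCycle σ ↔ σ.IsCycleOn Set.univ := by
  refine ⟨fun h => ⟨by simp [σ.bijective], fun x _ y hy => ?_⟩, fun h x y => ?_⟩
  · clear hy
    induction h x y with
    | refl => exact .refl _ _
    | tail _ hbc ih => subst hbc; exact Equiv.Perm.sameCycle_apply_right.2 ih
  · obtain ⟨n, -, rfl⟩ := (h.2 (Set.mem_univ x) (Set.mem_univ y)).exists_pow_eq'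
    induction n with
    | zero => exact .refl
    | succ n ih => exact ih.tail (by rw [pow_succ']; rfl)

theorem IsSingleCycle.mem_of_mapsTo (hf : IsSingleCycle f) {S : Set V} (hS : Set.MapsTo f S S)
    (ha : a ∈ S) (x : V) : x ∈ S := by
  induction hf a x with
  | refl => exact ha
  | tail _ hxy ih => exact hxy ▸ hS ih

theorem IsSingleCycle.card_le_two (hf : IsSingleCycle f) (ha : f (f a) = a) :
    Nat.card V ≤ 2 := by
  have hV : (Set.univ : Set V) ⊆ {a, f a} := fun x _ =>
    hf.mem_of_mapsTo (S := {a, f a}) (by rintro _ (rfl | rfl) <;> simp [ha]) (.inl rfl) x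
  rw [← Set.ncard_univ]
  exact (Set.ncard_le_ncard hV).trans ((Set.ncard_insert_le _ _).trans (by simp))

theorem IsSingleCycle.contract {π : V' → V} {f' : V' → V'} (hf' : IsSingleCycle f')
    (hπ : π.Surjective) (h : ∀ x, π (f' x) = π x ∨ f (π x) = π (f' x)) : IsSingleCycle f := by
  intro x y
  obtain ⟨x, rfl⟩ := hπ x
  obtain ⟨y, rfl⟩ := hπ y
  refine (hf' x y).lift' π fun c e hce => ?_
  subst hce
  rcases h c with hc | hc
  · simp only [Function.onFun, hc, ReflTransGen.refl]
  · exact .single hc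

theorem IsSingleCycle.expand {ι : V → V'} {f' : V' → V'} (hf : IsSingleCycle f)
    (hι : ∀ x, ReflTransGen (fun a b => f' a = b) (ι x) (ι (f x)))
    (hto : ∀ y, ∃ x, ReflTransGen (fun a b => f' a = b) y (ι x))
    (hfrom : ∀ y, ∃ x, ReflTransGen (fun a b => f' a = b) (ι x) y) : IsSingleCycle f' := by
  intro y z
  obtain ⟨x, hx⟩ := hto y
  obtain ⟨x', hx'⟩ := hfrom z
  exact (hx.trans ((hf x x').lift' ι fun c e hce => hce ▸ hι c)).trans hx'

theorem HasTraversal.hasTour (h : HasTraversal R a b) (hba : R b a) : HasTour R := by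
  obtain ⟨f, hf, hfb, hR⟩ := h
  refine ⟨⟨a⟩, f, hf, fun x => ?_⟩
  rcases eq_or_ne x b with rfl | hx
  exacts [hfb ▸ hba, hR x hx]

theorem HasTraversal.symm [Finite V] (hR : ∀ x y, R x y → R y x) (h : HasTraversal R a b) :
    HasTraversal R b a := by
  obtain ⟨f, hf, hfb, hfR⟩ := h
  let σ := Equiv.ofBijective f hf.bijective
  refine ⟨σ.symm, hf.of_rightInverse σ.left_inv, σ.symm_apply_eq.2 hfb.symm, fun x hx => ?_⟩
  have hy : f (σ.symm x) = x := σ.apply_symm_apply x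
  have hx' : σ.symm x ≠ b := fun h => hx (by rw [← hy, h, hfb])
  simpa only [hy] using hR _ _ (hfR _ hx')

theorem hasTraversal_of_isChain [Finite V] {l : List V} (hl : l.IsChain R) (hnd : l.Nodup)
    (hmem : ∀ x, x ∈ l) (ha : l.head? = some a) (hb : l.getLast? = some b) :
    HasTraversal R a b := by
  classical
  have hne : l ≠ [] := by rintro rfl; simp at ha
  obtain rfl : l.head hne = a := by simpa [List.head?_eq_some_head hne] using ha
  obtain rfl : l.getLast hne = b := by simpa [List.getLast?_eq_some_getLast hne] using hb
  have hcycle : l.formPerm.IsCycleOn Set.univ := by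
    have := hnd.isCycleOn_formPerm
    rwa [Set.eq_univ_of_forall (s := {x | x ∈ l}) hmem] at this
  refine ⟨l.formPerm, isSingleCycle_iff_isCycleOn.2 hcycle, ?_, fun x hx => ?_⟩
  · obtain ⟨x, t, rfl⟩ := List.exists_cons_of_ne_nil hne
    simp
  · obtain ⟨i, hi, rfl⟩ := List.getElem_of_mem (hmem x)
    have hi' : i + 1 < l.length := by
      by_contra h
      obtain rfl : i = l.length - 1 := by omega
      exact hx (List.getLast_eq_getElem hne).symm
    rw [List.formPerm_apply_lt_getElem _ hnd i hi']
    exact List.isChain_iff_getElem.1 hl i hi'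

end Tours

section TourEquiv

variable {V : Type*} {R : V → V → Prop} {f : V → V}

theorem isSingleCycle_add_one {n : ℕ} [NeZero n] : IsSingleCycle fun i : ZMod n => i + 1 := by
  intro i j
  have hreach (k : ℕ) : Relation.ReflTransGen (fun a b : ZMod n => a + 1 = b) i (i + k) := by
    induction k with
    | zero => simpa using .refl
    | succ k ih => exact ih.tail (by push_cast; ring)
  simpa using hreach (j - i).val

theorem IsSingleCycle.exists_equiv_zmod [Finite V] [Nonempty V] (hf : IsSingleCycle f) :
    ∃ e : ZMod (Nat.card V) ≃ V, ∀ i, f (e i) = e (i + 1) := by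
  have := Fintype.ofFinite V
  have : NeZero (Nat.card V) := ⟨Nat.card_pos.ne'⟩
  let σ : Equiv.Perm V := .ofBijective f hf.bijective
  obtain ⟨a⟩ := ‹Nonempty V›
  have hσ : σ.IsCycleOn (Finset.univ : Finset V) := by
    simpa using isSingleCycle_iff_isCycleOn.1 (show IsSingleCycle σ from hf)
  have hpow {m n : ℤ} : (σ ^ m) a = (σ ^ n) a ↔ m ≡ n [ZMOD Nat.card V] := by
    rw [Nat.card_eq_fintype_card]
    exact hσ.zpow_apply_eq_zpow_apply (Finset.mem_univ a)
  have hinj : Function.Injective fun i : ZMod (Nat.card V) => (σ ^ (i.cast : ℤ)) a :=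
    fun i j hij => by simpa using (ZMod.intCast_eq_intCast_iff _ _ _).2 (hpow.1 hij)
  refine ⟨.ofBijective _ (hinj.bijective_of_nat_card_le (by simp)), fun i => ?_⟩
  change σ ((σ ^ (i.cast : ℤ)) a) = (σ ^ ((i + 1).cast : ℤ)) a
  rw [← Equiv.Perm.mul_apply, ← zpow_one_add, hpow, ← ZMod.intCast_eq_intCast_iff]
  push_cast
  simp [add_comm]

theorem hasTour_iff_exists_equiv_zmod [Finite V] :
    HasTour R ↔ ∃ e : ZMod (Nat.card V) ≃ V, ∀ i, R (e i) (e (i + 1)) := by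
  constructor
  · rintro ⟨_, f, hf, hR⟩
    obtain ⟨e, he⟩ := hf.exists_equiv_zmod
    exact ⟨e, fun i => he i ▸ hR (e i)⟩
  · rintro ⟨e, he⟩
    have hV : Nonempty V := ⟨e 0⟩
    have : NeZero (Nat.card V) := ⟨Nat.card_pos.ne'⟩
    refine ⟨hV, fun x => e (e.symm x + 1), ?_, fun x => by simpa using he (e.symm x)⟩
    exact isSingleCycle_add_one.contract e.surjective fun i => .inr (by simp)

end TourEquiv

open SimpleGraph in
theorem isHamiltonian_of_hasTour {V : Type*} [DecidableEq V] [Fintype V]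
    {G : SimpleGraph V} (hV : 3 ≤ Fintype.card V) (hG : HasTour G.Adj) : G.IsHamiltonian := by
  obtain ⟨n, hn⟩ := Nat.exists_eq_add_of_le' hV
  rw [hasTour_iff_exists_equiv_zmod, Nat.card_eq_fintype_card, hn] at hG
  obtain ⟨e, he⟩ := hG
  have hom {i j : Fin (n + 3)} (h : (cycleGraph (n + 3)).Adj i j) : G.Adj (e i) (e j) := by
    rcases cycleGraph_adj.1 h with h | h
    · obtain rfl : i = j + 1 := by rw [← h]; abel
      exact (he j).symm
    · obtain rfl : j = i + 1 := by rw [← h]; abel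
      exact he i
  have hcycle : (cycleGraph.cycle n).IsHamiltonianCycle :=
    Walk.isHamiltonianCycle_iff_isCycle_and_length_eq.2
      ⟨cycleGraph.isCycle_cycle, by simp [cycleGraph.length_cycle]⟩
  exact fun _ => ⟨_, _, hcycle.map (f := ⟨e, hom⟩) e.bijective⟩

open SimpleGraph in
theorem hasTour_of_isHamiltonian {V : Type*} [DecidableEq V] [Fintype V]
    {G : SimpleGraph V} (hV : Fintype.card V ≠ 1) (hG : G.IsHamiltonian) : HasTour G.Adj := by
  obtain ⟨a, p, hp⟩ := hG hV
  rw [Walk.isHamiltonianCycle_iff_isCycle_and_support_count_tail_eq_one] at hp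
  obtain ⟨hcycle, hcount⟩ := hp
  cases p with
  | nil => exact absurd rfl hcycle.ne_nil
  | cons hadj q =>
    have hq := hcycle.support_nodup
    rw [Walk.support_cons, List.tail_cons] at hq hcount
    refine (hasTraversal_of_isChain q.isChain_adj_support hq
      (fun x => List.count_pos_iff.1 (by simp [hcount])) ?_ ?_).hasTour hadj
    · rw [List.head?_eq_some_head q.support_ne_nil, q.head_support]
    · rw [List.getLast?_eq_some_getLast q.support_ne_nil, q.getLast_support]

/-! ### Replacing a vertex by a gadget -/

namespace MixedGraph

/-- One can pass from `x` to `y` along an edge. -/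
def adj (M : MixedGraph) (x y : M.V) : Prop := M.Arc x y ∨ M.edge.Adj x y

/-- The graph has a Hamiltonian cycle, which respects the directions of the directed edges. -/
def Ham (M : MixedGraph) : Prop := HasTour M.adj

theorem adj_irrefl (M : MixedGraph) (x : M.V) : ¬ M.adj x x :=
  not_or.2 ⟨M.arc_irrefl x, M.edge.irrefl⟩

theorem adj_iff_exists_incident_left {M : MixedGraph} {u w : M.V} :
    M.adj u w ↔ ∃ x ∈ M.incident w, x.1 ≠ Kind.out ∧ x.2 = u := by
  constructor
  · rintro (h | h)
    · exact ⟨(Kind.inc, u), h, by simp, rfl⟩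
    · exact ⟨(Kind.und, u), h.symm, by simp, rfl⟩
  · rintro ⟨⟨_ | _ | _, u⟩, hx, hk, rfl⟩
    · exact .inl hx
    · exact absurd rfl hk
    · exact .inr (M.edge.adj_symm hx)

theorem adj_iff_exists_incident_right {M : MixedGraph} {u w : M.V} :
    M.adj w u ↔ ∃ x ∈ M.incident w, x.1 ≠ Kind.inc ∧ x.2 = u := by
  constructor
  · rintro (h | h)
    · exact ⟨(Kind.out, u), h, by simp, rfl⟩
    · exact ⟨(Kind.und, u), h, by simp, rfl⟩
  · rintro ⟨⟨_ | _ | _, u⟩, hx, hk, rfl⟩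
    · exact absurd rfl hk
    · exact .inl hx
    · exact .inr hx

section Replace

variable {M : MixedGraph} {v : M.V} {H : MixedGraph} {p : Kind × M.V → H.V}

/-- The vertex of `M.replace v H p` given by a vertex of `M` other than `v`. -/
def outer (w : {w : M.V // w ≠ v}) : (M.replace v H p).V := Sum.inl w

/-- The vertex of `M.replace v H p` given by a vertex of `H`. -/
def inner (h : H.V) : (M.replace v H p).V := Sum.inr h

/-- The map to the vertices of `M` that shrinks `H` to the vertex `v` it has replaced. -/
def collapse : (M.replace v H p).V → M.V := Sum.elim Subtype.val fun _ => v

theorem outer_injective : Function.Injective (outer : _ → (M.replace v H p).V) :=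
  Sum.inl_injective

theorem inner_injective : Function.Injective (inner : _ → (M.replace v H p).V) :=
  Sum.inr_injective

theorem outer_ne_inner (w : {w : M.V // w ≠ v}) (h : H.V) :
    (outer w : (M.replace v H p).V) ≠ inner h := Sum.inl_ne_inr

theorem outer_or_inner (x : (M.replace v H p).V) : (∃ w, outer w = x) ∨ ∃ h, inner h = x :=
  match x with
  | .inl w => .inl ⟨w, rfl⟩
  | .inr h => .inr ⟨h, rfl⟩

theorem collapse_surjective [Nonempty H.V] :
    Function.Surjective (collapse : (M.replace v H p).V → M.V) := fun w => by
  rcases eq_or_ne w v with rfl | hw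
  exacts [⟨inner (Classical.arbitrary _), rfl⟩, ⟨outer ⟨w, hw⟩, rfl⟩]

theorem adj_outer_inner {a : {w : M.V // w ≠ v}} {h : H.V} :
    (M.replace v H p).adj (outer a) (inner h) ↔
      ∃ x ∈ M.incident v, x.1 ≠ Kind.out ∧ x.2 = a ∧ p x = h := by
  constructor
  · rintro (⟨hx, hp⟩ | ⟨hx, hp⟩)
    · exact ⟨(Kind.inc, a), hx, by simp, rfl, hp⟩
    · exact ⟨(Kind.und, a), hx, by simp, rfl, hp⟩
  · rintro ⟨⟨_ | _ | _, u⟩, hx, hk, rfl, hp⟩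
    · exact .inl ⟨hx, hp⟩
    · exact absurd rfl hk
    · exact .inr ⟨hx, hp⟩

theorem adj_inner_outer {a : {w : M.V // w ≠ v}} {h : H.V} :
    (M.replace v H p).adj (inner h) (outer a) ↔
      ∃ x ∈ M.incident v, x.1 ≠ Kind.inc ∧ x.2 = a ∧ p x = h := by
  constructor
  · rintro (⟨hx, hp⟩ | ⟨hx, hp⟩)
    · exact ⟨(Kind.out, a), hx, by simp, rfl, hp⟩
    · exact ⟨(Kind.und, a), hx, by simp, rfl, hp⟩
  · rintro ⟨⟨_ | _ | _, u⟩, hx, hk, rfl, hp⟩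
    · exact absurd rfl hk
    · exact .inl ⟨hx, hp⟩
    · exact .inr ⟨hx, hp⟩

theorem adj_collapse_of_adj {x y : (M.replace v H p).V} (h : (M.replace v H p).adj x y) :
    collapse x = v ∧ collapse y = v ∨ M.adj (collapse x) (collapse y) := by
  rcases outer_or_inner x with ⟨u, rfl⟩ | ⟨a, rfl⟩ <;>
    rcases outer_or_inner y with ⟨w, rfl⟩ | ⟨b, rfl⟩
  · exact .inr h
  · obtain ⟨e, he, hk, hu, -⟩ := adj_outer_inner.1 h
    exact .inr (adj_iff_exists_incident_left.2 ⟨e, he, hk, hu⟩)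
  · obtain ⟨e, he, hk, hw, -⟩ := adj_inner_outer.1 h
    exact .inr (adj_iff_exists_incident_right.2 ⟨e, he, hk, hw⟩)
  · exact .inl ⟨rfl, rfl⟩

open Classical in
/-- The successor map on the vertices of `M.replace v H p` which follows `f`, except that it visits
`H` along `g`, from `a` to `b`, instead of the vertex `v`. -/
noncomputable def splice (f : M.V → M.V) (hfv : f v ≠ v) (g : H.V → H.V) (a b : H.V) :
    (M.replace v H p).V → (M.replace v H p).V :=
  Sum.elim (fun w => if hw : f w = v then inner a else outer ⟨f w, hw⟩)
    fun h => if h = b then outer ⟨f v, hfv⟩ else inner (g h)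

section Splice

variable {f : M.V → M.V} {hfv : f v ≠ v} {g : H.V → H.V} {a b : H.V}

theorem splice_outer_of_eq {w : {w : M.V // w ≠ v}} (hw : f w = v) :
    splice f hfv g a b (outer w : (M.replace v H p).V) = inner a :=
  dif_pos hw

theorem splice_outer_of_ne {w : {w : M.V // w ≠ v}} (hw : f w ≠ v) :
    splice f hfv g a b (outer w : (M.replace v H p).V) = outer ⟨f w, hw⟩ :=
  dif_neg hw

theorem splice_inner_self :
    splice f hfv g a b (inner b : (M.replace v H p).V) = outer ⟨f v, hfv⟩ :=
  if_pos rfl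

theorem splice_inner_of_ne {h : H.V} (hh : h ≠ b) :
    splice f hfv g a b (inner h : (M.replace v H p).V) = inner (g h) :=
  if_neg hh

theorem isSingleCycle_splice (hf : IsSingleCycle f) (hg : IsSingleCycle g) (hgb : g b = a) :
    IsSingleCycle (splice f hfv g a b : (M.replace v H p).V → (M.replace v H p).V) := by
  classical
  set f' : (M.replace v H p).V → (M.replace v H p).V := splice f hfv g a b
  have from_a (h : H.V) : ReflTransGen (fun x y => f' x = y) (inner a) (inner h) := by
    induction hg a h with
    | refl => exact .refl
    | @tail c e _ hce ih =>
      rcases eq_or_ne c b with rfl | hc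
      · exact hce ▸ hgb ▸ .refl
      · exact ih.tail (hce ▸ splice_inner_of_ne hc)
  have to_b (h : H.V) : ReflTransGen (fun x y => f' x = y) (inner h) (inner b) := by
    induction hg h b using ReflTransGen.head_induction_on with
    | refl => exact .refl
    | @head c e hce _ ih =>
      rcases eq_or_ne c b with rfl | hc
      · exact .refl
      · exact ih.head (hce ▸ splice_inner_of_ne hc)
  let ι (w : M.V) : (M.replace v H p).V := if hw : w = v then inner a else outer ⟨w, hw⟩
  have hιv : ι v = inner a := dif_pos rfl
  have hι (w : {w : M.V // w ≠ v}) : ι w = outer w := dif_neg w.2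
  refine hf.expand (ι := ι) (fun w => ?_) (fun y => ?_) fun y => ?_
  · rcases eq_or_ne w v with rfl | hw
    · rw [hιv]
      exact (to_b a).tail (splice_inner_self.trans (hι ⟨f w, hfv⟩).symm)
    · rw [hι ⟨w, hw⟩]
      rcases eq_or_ne (f w) v with hfw | hfw
      · exact .single ((splice_outer_of_eq hfw).trans ((congrArg ι hfw).trans hιv).symm)
      · exact .single ((splice_outer_of_ne hfw).trans (hι ⟨f w, hfw⟩).symm)
  · rcases outer_or_inner y with ⟨w, rfl⟩ | ⟨h, rfl⟩
    · exact ⟨w, hι w ▸ .refl⟩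
    · exact ⟨f v, (to_b h).tail (splice_inner_self.trans (hι ⟨f v, hfv⟩).symm)⟩
  · rcases outer_or_inner y with ⟨w, rfl⟩ | ⟨h, rfl⟩
    · exact ⟨w, hι w ▸ .refl⟩
    · exact ⟨v, hιv ▸ from_a h⟩

end Splice

theorem Ham.replace
    (hH : ∀ x ∈ M.incident v, ∀ y ∈ M.incident v, x ≠ y → x.1 ≠ Kind.out → y.1 ≠ Kind.inc →
      HasTraversal H.adj (p x) (p y))
    (hM : (∀ w, ¬ M.edge.Adj v w) ∨ 3 ≤ Nat.card M.V) (h : M.Ham) :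
    (M.replace v H p).Ham := by
  obtain ⟨-, f, hf, hfM⟩ := h
  have hfv : f v ≠ v := fun h => M.adj_irrefl v (by simpa only [h] using hfM v)
  obtain ⟨u, hu⟩ := hf.surjective v
  obtain ⟨x, hx, hxk, hxu⟩ := adj_iff_exists_incident_left.1 (hu ▸ hfM u)
  obtain ⟨y, hy, hyk, hyv⟩ := adj_iff_exists_incident_right.1 (hfM v)
  have hxy : x ≠ y := by
    rintro rfl
    obtain ⟨_ | _ | _, w⟩ := x
    · exact hyk rfl
    · exact hxk rfl
    · rcases hM with hM | hM
      · exact hM w hx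
      · have := hf.card_le_two (a := v) (by rw [← hyv, hxu, hu])
        omega
  obtain ⟨g, hg, hgy, hgH⟩ := hH x hx y hy hxy hxk hyk
  refine ⟨⟨outer ⟨f v, hfv⟩⟩, splice f hfv g (p x) (p y), isSingleCycle_splice hf hg hgy, ?_⟩
  intro z
  rcases outer_or_inner z with ⟨w, rfl⟩ | ⟨h, rfl⟩
  · rcases eq_or_ne (f w) v with hw | hw
    · rw [splice_outer_of_eq hw]
      have huw : u = w := hf.bijective.injective (hu.trans hw.symm)
      exact adj_outer_inner.2 ⟨x, hx, hxk, hxu.trans huw, rfl⟩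
    · rw [splice_outer_of_ne hw]
      exact hfM w
  · rcases eq_or_ne h (p y) with rfl | hh
    · rw [splice_inner_self]
      exact adj_inner_outer.2 ⟨y, hy, hyk, hyv, rfl⟩
    · rw [splice_inner_of_ne hh]
      exact hgH h hh

theorem exists_exit [Nonempty H.V] (hv : ∃ u, u ≠ v)
    {f : (M.replace v H p).V → (M.replace v H p).V} (hf : IsSingleCycle f) :
    ∃ h w, f (inner h) = outer w := by
  by_contra! hno
  obtain ⟨u, hu⟩ := hv
  have hmaps : Set.MapsTo f (Set.range inner) (Set.range inner) := by
    rintro _ ⟨h, rfl⟩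
    rcases outer_or_inner (f (inner h)) with ⟨w, hw⟩ | hh
    exacts [absurd hw.symm (hno h w), hh]
  obtain ⟨h, hh⟩ := hf.mem_of_mapsTo hmaps ⟨Classical.arbitrary _, rfl⟩ (outer ⟨u, hu⟩)
  exact outer_ne_inner _ _ hh.symm

theorem Ham.of_replace [Nonempty H.V] (hv : ∃ u, u ≠ v)
    (hexit : ∀ f, IsSingleCycle f → (∀ x, (M.replace v H p).adj x (f x)) →
      ∀ h h' w w', f (inner h) = outer w → f (inner h') = outer w' → h = h')
    (h : (M.replace v H p).Ham) : M.Ham := by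
  classical
  obtain ⟨-, f', hf', hfM⟩ := h
  obtain ⟨b, w, hb⟩ := exists_exit hv hf'
  let f (u : M.V) : M.V := if hu : u = v then w else collapse (f' (outer ⟨u, hu⟩))
  have hfv : f v = w := dif_pos rfl
  have hfo (u : {u : M.V // u ≠ v}) : f u = collapse (f' (outer u)) := dif_neg u.2
  refine ⟨⟨v⟩, f, hf'.contract collapse_surjective fun x => ?_, fun u => ?_⟩
  · rcases outer_or_inner x with ⟨u, rfl⟩ | ⟨h, rfl⟩
    · exact .inr (hfo u)
    · rcases outer_or_inner (f' (inner h)) with ⟨w', hw'⟩ | ⟨h', hh'⟩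
      · obtain rfl := hexit f' hf' hfM h b w' w hw'.symm hb
        exact .inr (hfv.trans (congrArg collapse hb.symm))
      · exact .inl (hh' ▸ rfl)
  · rcases eq_or_ne u v with rfl | hu
    · rw [hfv]
      have hbw := hb ▸ hfM (inner b)
      exact (adj_collapse_of_adj hbw).resolve_left fun h => w.2 h.2
    · rw [hfo ⟨u, hu⟩]
      exact (adj_collapse_of_adj (hfM (outer ⟨u, hu⟩))).resolve_left fun h => hu h.1

end Replace

end MixedGraph

instance : Finite Kind :=
  Set.finite_univ_iff.1 ((Set.toFinite {Kind.inc, Kind.out, Kind.und}).subset fun k _ => by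
    cases k <;> simp)

namespace MixedGraph

section Exit

variable {M : MixedGraph} {v : M.V} {H : MixedGraph} {p : Kind × M.V → H.V}

theorem exists_entry (hv : ∃ u, u ≠ v) [Nonempty H.V]
    {f : (M.replace v H p).V → (M.replace v H p).V} (hf : IsSingleCycle f) :
    ∃ w h, f (outer w) = inner h := by
  by_contra! hno
  obtain ⟨u, hu⟩ := hv
  have hmaps : Set.MapsTo f (Set.range outer) (Set.range outer) := by
    rintro _ ⟨w, rfl⟩
    rcases outer_or_inner (f (outer w)) with hw | ⟨h, hh⟩
    exacts [hw, absurd hh.symm (hno w h)]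
  obtain ⟨w, hw⟩ := hf.mem_of_mapsTo hmaps ⟨⟨u, hu⟩, rfl⟩ (inner (Classical.arbitrary H.V))
  exact outer_ne_inner _ _ hw

theorem Ham.of_replace_of_degree_le_two [Nonempty H.V] (hv : ∃ u, u ≠ v) (hdeg : M.degree v ≤ 2)
    (hcard : 3 ≤ Nat.card (M.replace v H p).V) (h : (M.replace v H p).Ham) : M.Ham := by
  refine h.of_replace hv fun f hf hfM h h' w w' hw hw' => ?_
  by_contra hne
  obtain ⟨x, hx, -, hxw, hxh⟩ := adj_inner_outer.1 (hw ▸ hfM (inner h))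
  obtain ⟨x', hx', -, hxw', hxh'⟩ := adj_inner_outer.1 (hw' ▸ hfM (inner h'))
  obtain ⟨u, a, hu⟩ := exists_entry hv hf
  obtain ⟨y, hy, -, hyu, hya⟩ := adj_outer_inner.1 (hu ▸ hfM (outer u))
  have hyx : y = x ∨ y = x' := by
    by_contra! hyx
    have hxx' : x ≠ x' := by rintro rfl; exact hne (hxh.symm.trans hxh')
    have := (Set.two_lt_ncard (Set.toFinite _)).2 ⟨y, hy, x, hx, x', hx', hyx.1, hyx.2, hxx'⟩
    exact absurd hdeg this.not_ge
  have htwo : f (f (outer u)) = outer u := by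
    rcases hyx with rfl | rfl
    · rw [hu, ← hya, hxh, hw, Subtype.ext (hyu.symm.trans hxw)]
    · rw [hu, ← hya, hxh', hw', Subtype.ext (hyu.symm.trans hxw')]
  exact absurd (hf.card_le_two htwo) (by omega)

/-- A function on `H`, extended by zero to the vertices outside `H`. -/
def extendZero (W : H.V → ℤ) : (M.replace v H p).V → ℤ := Sum.elim 0 W

theorem extendZero_outer (W : H.V → ℤ) (w : {w : M.V // w ≠ v}) :
    extendZero W (outer w : (M.replace v H p).V) = 0 := rfl

theorem extendZero_inner (W : H.V → ℤ) (h : H.V) :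
    extendZero W (inner h : (M.replace v H p).V) = W h := rfl

theorem sum_extendZero [Fintype H.V] [Fintype (M.replace v H p).V] (W : H.V → ℤ) :
    ∑ x : (M.replace v H p).V, extendZero W x = ∑ h, W h := by
  refine (Finset.sum_of_injOn inner inner_injective.injOn (by simp) (fun x _ hx => ?_)
    fun h _ => rfl).symm
  rcases outer_or_inner x with ⟨w, rfl⟩ | ⟨h, rfl⟩
  exacts [rfl, absurd ⟨h, by simp, rfl⟩ hx]

theorem extendZero_sub_extendZero_of_adj {W φ : H.V → ℤ}
    (hin : ∀ x ∈ M.incident v, x.1 ≠ Kind.out → φ (p x) = 0)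
    (hout : ∀ x ∈ M.incident v, x.1 ≠ Kind.inc → φ (p x) = W (p x) - 1)
    (hH : ∀ a b, H.adj a b → φ a = W a + φ b) {x y : (M.replace v H p).V}
    (h : (M.replace v H p).adj x y)
    [Decidable ((∃ a, inner a = x) ∧ ∃ w, outer w = y)] :
    extendZero φ x - extendZero φ y =
      extendZero W x - if (∃ a, inner a = x) ∧ ∃ w, outer w = y then 1 else 0 := by
  rcases outer_or_inner x with ⟨u, rfl⟩ | ⟨a, rfl⟩ <;>
    rcases outer_or_inner y with ⟨w, rfl⟩ | ⟨b, rfl⟩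
  · rw [if_neg fun h => h.1.elim fun a ha => outer_ne_inner _ _ ha.symm]
    simp only [extendZero_outer, sub_zero]
  · obtain ⟨e, he, hk, -, rfl⟩ := adj_outer_inner.1 h
    rw [if_neg fun h => h.1.elim fun a ha => outer_ne_inner _ _ ha.symm]
    simp only [extendZero_outer, extendZero_inner, hin e he hk, sub_zero]
  · obtain ⟨e, he, hk, -, rfl⟩ := adj_inner_outer.1 h
    rw [if_pos ⟨⟨_, rfl⟩, w, rfl⟩]
    simp only [extendZero_outer, extendZero_inner, hout e he hk, sub_zero]
  · rw [if_neg fun h => h.2.elim fun w hw => outer_ne_inner _ _ hw]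
    simp only [extendZero_inner, hH a b h, sub_zero, add_sub_cancel_right]

-- Summing the increments of the potential `φ` over the whole cycle shows that there are exactly
-- `∑ h, W h` exits from `H`.
theorem Ham.of_replace_of_weight [Fintype H.V] (hv : ∃ u, u ≠ v) (W φ : H.V → ℤ)
    (hW : ∑ h, W h = 1)
    (hin : ∀ x ∈ M.incident v, x.1 ≠ Kind.out → φ (p x) = 0)
    (hout : ∀ x ∈ M.incident v, x.1 ≠ Kind.inc → φ (p x) = W (p x) - 1)
    (hH : ∀ a b, H.adj a b → φ a = W a + φ b) (h : (M.replace v H p).Ham) : M.Ham := by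
  classical
  have : Nonempty H.V := by
    by_contra hempty
    simp [not_nonempty_iff.1 hempty] at hW
  refine h.of_replace hv fun f hf hfM h h' w w' hw hw' => ?_
  have : Fintype (M.replace v H p).V := Fintype.ofFinite _
  let exits : Finset (M.replace v H p).V := {x | (∃ a, inner a = x) ∧ ∃ w, outer w = f x}
  have hcard : (exits.card : ℤ) = 1 :=
    calc (exits.card : ℤ)
        = ∑ x, (extendZero W x - (extendZero φ x - extendZero φ (f x))) := by
          rw [Finset.natCast_card_filter]
          exact Finset.sum_congr rfl fun x _ => by
            rw [extendZero_sub_extendZero_of_adj hin hout hH (hfM x), sub_sub_cancel]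
      _ = 1 := by
          rw [Finset.sum_sub_distrib, Finset.sum_sub_distrib, hf.bijective.sum_comp,
            sum_extendZero, hW, sub_self, sub_zero]
  refine inner_injective (Finset.card_le_one.1 (Nat.cast_injective hcard).le _ ?_ _ ?_)
  · exact Finset.mem_filter.2 ⟨Finset.mem_univ _, ⟨h, rfl⟩, w, hw.symm⟩
  · exact Finset.mem_filter.2 ⟨Finset.mem_univ _, ⟨h', rfl⟩, w', hw'.symm⟩

end Exit

end MixedGraph

/-! ### Degrees -/

/-- The kind of an edge, as seen from its other end. -/
def Kind.flip : Kind → Kind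
  | .inc => .out
  | .out => .inc
  | .und => .und

theorem Kind.ncard_eq_add_add {α : Type*} [Finite α] (s : Set (Kind × α)) :
    s.ncard = {u | (Kind.inc, u) ∈ s}.ncard + {u | (Kind.out, u) ∈ s}.ncard +
      {u | (Kind.und, u) ∈ s}.ncard := by
  let fiber (k : Kind) : Set (Kind × α) := Prod.mk k '' {u | (k, u) ∈ s}
  have hfiber (k : Kind) : (fiber k).ncard = {u | (k, u) ∈ s}.ncard :=
    Set.ncard_image_of_injective _ (Prod.mk_right_injective k)
  have hdisj {k l : Kind} (hkl : k ≠ l) : Disjoint (fiber k) (fiber l) := by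
    rw [Set.disjoint_left]
    rintro _ ⟨u, -, rfl⟩ ⟨w, -, h⟩
    exact hkl (Prod.mk.inj h).1.symm
  have hs : s = fiber .inc ∪ fiber .out ∪ fiber .und := by
    ext ⟨_ | _ | _, u⟩ <;> simp [fiber]
  rw [← hfiber, ← hfiber, ← hfiber, ← Set.ncard_union_eq (hdisj (by simp)),
    ← Set.ncard_union_eq (Set.disjoint_union_left.2 ⟨hdisj (by simp), hdisj (by simp)⟩), ← hs]

namespace MixedGraph

/-- The number of edges of kind `k` incident with `v`. -/
noncomputable def kdeg (M : MixedGraph) (k : Kind) (v : M.V) : ℕ :=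
  {u | (k, u) ∈ M.incident v}.ncard

theorem degree_eq_kdeg_add_kdeg_add_kdeg (M : MixedGraph) (v : M.V) :
    M.degree v = M.kdeg .inc v + M.kdeg .out v + M.kdeg .und v :=
  Kind.ncard_eq_add_add _

/-- The sum of a function over all vertices. -/
noncomputable def total (M : MixedGraph) (f : M.V → ℕ) : ℕ := ∑ᶠ v, f v

theorem total_eq_sum (M : MixedGraph) [Fintype M.V] (f : M.V → ℕ) : M.total f = ∑ v, f v :=
  finsum_eq_sum_of_fintype f

theorem total_mono {M : MixedGraph} {f g : M.V → ℕ} (h : ∀ v, f v ≤ g v) :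
    M.total f ≤ M.total g := by
  have := Fintype.ofFinite M.V
  rw [total_eq_sum, total_eq_sum]
  exact Finset.sum_le_sum fun v _ => h v

theorem total_const (M : MixedGraph) (c : ℕ) : M.total (fun _ => c) = Nat.card M.V * c := by
  have := Fintype.ofFinite M.V
  simp [total_eq_sum]

theorem total_add (M : MixedGraph) (f g : M.V → ℕ) :
    M.total (fun v => f v + g v) = M.total f + M.total g :=
  finsum_add_distrib (Set.toFinite _) (Set.toFinite _)

theorem total_mul (M : MixedGraph) (c : ℕ) (f : M.V → ℕ) :
    M.total (fun v => c * f v) = c * M.total f := by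
  have := Fintype.ofFinite M.V
  simp only [total_eq_sum, Finset.mul_sum]

section Replace

variable {M : MixedGraph} {v : M.V} {H : MixedGraph} {p : Kind × M.V → H.V}

theorem total_replace {f : (M.replace v H p).V → ℕ} {g : M.V → ℕ} (h : ∀ w, f (outer w) = g w) :
    (M.replace v H p).total f + g v = M.total g + H.total fun h => f (inner h) := by
  classical
  have := Fintype.ofFinite M.V
  have := Fintype.ofFinite H.V
  let : Fintype (M.replace v H p).V := instFintypeSum {w : M.V // w ≠ v} H.V
  have hsum : ∑ x, f x = ∑ w, f (outer w) + ∑ h, f (inner h) := Fintype.sum_sum_type f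
  rw [total_eq_sum, total_eq_sum, total_eq_sum, hsum, Fintype.sum_eq_add_sum_subtype_ne g v]
  simp only [h]
  omega

theorem outer_mem_incident_outer {k : Kind} {a w : {w : M.V // w ≠ v}} :
    (k, outer a) ∈ (M.replace v H p).incident (outer w) ↔ (k, a.1) ∈ M.incident w := by
  cases k <;> rfl

theorem inner_mem_incident_outer {k : Kind} {h : H.V} {w : {w : M.V // w ≠ v}} :
    (k, inner h) ∈ (M.replace v H p).incident (outer w) ↔
      (k, v) ∈ M.incident w ∧ p (k.flip, w) = h := by
  cases k
  · rfl
  · rfl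
  · exact and_congr_left fun _ => M.edge.adj_comm _ _

theorem outer_mem_incident_inner {k : Kind} {h : H.V} {w : {w : M.V // w ≠ v}} :
    (k, outer w) ∈ (M.replace v H p).incident (inner h) ↔
      (k, w.1) ∈ M.incident v ∧ p (k, w) = h := by
  cases k <;> rfl

theorem inner_mem_incident_inner {k : Kind} {h h' : H.V} :
    (k, inner h') ∈ (M.replace v H p).incident (inner h) ↔ (k, h') ∈ H.incident h := by
  cases k <;> rfl

theorem not_mem_incident_self {k : Kind} : (k, v) ∉ M.incident v := by
  cases k
  exacts [M.arc_irrefl v, M.arc_irrefl v, M.edge.irrefl]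

theorem kdeg_outer (k : Kind) (w : {w : M.V // w ≠ v}) :
    (M.replace v H p).kdeg k (outer w) = M.kdeg k w := by
  have hinj : Set.InjOn collapse {x | (k, x) ∈ (M.replace v H p).incident (outer w)} := by
    intro x hx y hy hxy
    rcases outer_or_inner x with ⟨a, rfl⟩ | ⟨h, rfl⟩ <;>
      rcases outer_or_inner y with ⟨b, rfl⟩ | ⟨h', rfl⟩
    · exact congrArg outer (Subtype.ext hxy)
    · exact absurd hxy a.2
    · exact absurd hxy.symm b.2
    · rw [← (inner_mem_incident_outer.1 hx).2, ← (inner_mem_incident_outer.1 hy).2]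
  rw [kdeg, kdeg, ← hinj.ncard_image]
  congr 1
  ext u
  constructor
  · rintro ⟨x, hx, rfl⟩
    rcases outer_or_inner x with ⟨a, rfl⟩ | ⟨h, rfl⟩
    exacts [outer_mem_incident_outer.1 hx, (inner_mem_incident_outer.1 hx).1]
  · intro hu
    rcases eq_or_ne u v with rfl | huv
    · exact ⟨inner _, inner_mem_incident_outer.2 ⟨hu, rfl⟩, rfl⟩
    · exact ⟨outer ⟨u, huv⟩, outer_mem_incident_outer.2 hu, rfl⟩

variable (p) in
/-- The number of external edges of kind `k` at the vertex `h` of `H`. -/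
noncomputable def attached (v : M.V) (k : Kind) (h : H.V) : ℕ :=
  {u | (k, u) ∈ M.incident v ∧ p (k, u) = h}.ncard

theorem kdeg_inner (k : Kind) (h : H.V) :
    (M.replace v H p).kdeg k (inner h) = H.kdeg k h + attached p v k h := by
  let external : Set {w : M.V // w ≠ v} := {w | (k, w.1) ∈ M.incident v ∧ p (k, w) = h}
  have hset : {x | (k, x) ∈ (M.replace v H p).incident (inner h)} =
      inner '' {h' | (k, h') ∈ H.incident h} ∪ outer '' external := by
    ext x
    constructor
    · intro hx
      rcases outer_or_inner x with ⟨a, rfl⟩ | ⟨h', rfl⟩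
      · exact .inr ⟨a, outer_mem_incident_inner.1 hx, rfl⟩
      · exact .inl ⟨h', inner_mem_incident_inner.1 hx, rfl⟩
    · rintro (⟨h', hh', rfl⟩ | ⟨a, ha, rfl⟩)
      exacts [inner_mem_incident_inner.2 hh', outer_mem_incident_inner.2 ha]
  have hdisj : Disjoint (inner '' {h' | (k, h') ∈ H.incident h} : Set (M.replace v H p).V)
      (outer '' external) := by
    rw [Set.disjoint_left]
    rintro _ ⟨a, -, rfl⟩ ⟨b, -, hb⟩
    exact outer_ne_inner _ _ hb
  have hexternal : external.ncard = attached p v k h := by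
    rw [attached, ← Set.ncard_image_of_injective _ Subtype.val_injective]
    congr 1
    ext u
    constructor
    · rintro ⟨w, hw, rfl⟩
      exact hw
    · exact fun hu => ⟨⟨u, fun h => not_mem_incident_self (h ▸ hu.1)⟩, hu, rfl⟩
  rw [kdeg, hset, Set.ncard_union_eq hdisj, Set.ncard_image_of_injective _ inner_injective,
    Set.ncard_image_of_injective _ outer_injective, hexternal, kdeg]

theorem attached_eq_zero {k : Kind} {h : H.V} (hp : ∀ u, (k, u) ∈ M.incident v → p (k, u) ≠ h) :
    attached p v k h = 0 :=
  (Set.ncard_eq_zero (Set.toFinite _)).2 <|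
    Set.eq_empty_iff_forall_notMem.2 fun u hu => hp u hu.1 hu.2

theorem attached_eq_kdeg {k : Kind} {h : H.V} (hp : ∀ u, (k, u) ∈ M.incident v → p (k, u) = h) :
    attached p v k h = M.kdeg k v :=
  congrArg Set.ncard <| Set.ext fun u => and_iff_left_of_imp (hp u)

theorem attached_add_attached {k : Kind} {a b : H.V} (hab : a ≠ b)
    (hp : ∀ u, (k, u) ∈ M.incident v → p (k, u) = a ∨ p (k, u) = b) :
    attached p v k a + attached p v k b = M.kdeg k v := by
  rw [attached, attached, kdeg, ← Set.ncard_union_eq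
    (Set.disjoint_left.2 fun u ha hb => hab (ha.2.symm.trans hb.2))]
  congr 1
  ext u
  have := hp u
  simp only [Set.mem_union, Set.mem_ofPred_eq]
  tauto

theorem degree_outer (w : {w : M.V // w ≠ v}) :
    (M.replace v H p).degree (outer w) = M.degree w := by
  simp only [degree_eq_kdeg_add_kdeg_add_kdeg, kdeg_outer]

theorem degree_inner (h : H.V) :
    (M.replace v H p).degree (inner h) = H.degree h + {x ∈ M.incident v | p x = h}.ncard := by
  rw [Kind.ncard_eq_add_add {x ∈ M.incident v | p x = h}, degree_eq_kdeg_add_kdeg_add_kdeg,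
    degree_eq_kdeg_add_kdeg_add_kdeg, kdeg_inner, kdeg_inner, kdeg_inner]
  simp only [attached, Set.mem_ofPred_eq]
  omega

open Classical in
theorem degree_inner_of_bijOn {S : Set H.V} (hp : Set.BijOn p (M.incident v) S) (h : H.V) :
    (M.replace v H p).degree (inner h) = H.degree h + if h ∈ S then 1 else 0 := by
  rw [degree_inner]
  congr 1
  split_ifs with hS
  · obtain ⟨x, hx, rfl⟩ := hp.surjOn hS
    refine Set.ncard_eq_one.2 ⟨x, Set.eq_singleton_iff_unique_mem.2 ⟨⟨hx, rfl⟩, ?_⟩⟩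
    exact fun y hy => hp.injOn hy.1 hx hy.2
  · refine (Set.ncard_eq_zero (Set.toFinite _)).2 (Set.eq_empty_iff_forall_notMem.2 ?_)
    rintro x ⟨hx, rfl⟩
    exact hS (hp.mapsTo hx)

end Replace

end MixedGraph

theorem LoopTerminates.exists_runLoop {α : Type*} {step : α → α → Prop} (h : LoopTerminates step)
    (a : α) : ∃ b, RunLoop step a b := by
  induction a using h.induction with
  | _ a ih =>
    by_cases ha : ∃ c, step a c
    · obtain ⟨c, hc⟩ := ha
      obtain ⟨b, hb, hb'⟩ := ih c hc
      exact ⟨b, hb.head hc, hb'⟩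
    · exact ⟨a, .refl, not_exists.1 ha⟩

theorem LoopTerminates.of_measure {α : Type*} {step : α → α → Prop} (f : α → ℕ)
    (h : ∀ a b, step a b → f b < f a) : LoopTerminates step :=
  Subrelation.wf (fun {_ _} hab => h _ _ hab) (measure f).wf

theorem invariant_of_reflTransGen {α : Type*} {step : α → α → Prop} {P : α → Prop} {a b : α}
    (hab : ReflTransGen step a b) (ha : P a) (h : ∀ a b, step a b → P a → P b) : P b := by
  induction hab with
  | refl => exact ha
  | tail _ hbc ih => exact h _ _ hbc ih

theorem exists_balanced_map {α β : Type*} [Finite α] (S : Set α) {a b : β} (hab : a ≠ b) :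
    ∃ q : α → β, (∀ u, q u = a ∨ q u = b) ∧
      {u | u ∈ S ∧ q u = a}.ncard ≤ {u | u ∈ S ∧ q u = b}.ncard + 1 ∧
      {u | u ∈ S ∧ q u = b}.ncard ≤ {u | u ∈ S ∧ q u = a}.ncard + 1 := by
  classical
  obtain ⟨T, hT, hcard⟩ := Set.exists_subset_card_eq (s := S) (n := S.ncard / 2) (by omega)
  let q (u : α) : β := if u ∈ T then a else b
  have ha : {u | u ∈ S ∧ q u = a} = T := by
    ext u
    simpa [q, hab.symm] using @hT u
  have hb : {u | u ∈ S ∧ q u = b} = S \ T := by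
    ext u
    simp [q, hab]
  have := Set.ncard_sdiff_add_ncard_of_subset hT
  refine ⟨q, fun u => ite_eq_or_eq .., ?_, ?_⟩ <;> rw [ha, hb] <;> omega

namespace MixedGraph

/-- All edges are directed. -/
def NoUnd (M : MixedGraph) : Prop := ∀ x y, ¬ M.edge.Adj x y

section Replace

variable {M : MixedGraph} {v : M.V} {H : MixedGraph} {p : Kind × M.V → H.V}

theorem NoUnd.replace (hM : M.NoUnd) (hH : H.NoUnd) : (M.replace v H p).NoUnd := by
  rintro (a | a) (b | b)
  exacts [hM _ _, fun h => hM _ _ h.1, fun h => hM _ _ h.1, hH _ _]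

theorem NoUnd.kdeg_und (hM : M.NoUnd) (v : M.V) : M.kdeg .und v = 0 :=
  (Set.ncard_eq_zero (Set.toFinite _)).2 <| Set.eq_empty_iff_forall_notMem.2 fun _ => hM _ _

theorem NoUnd.ham_replace_iff [Fintype H.V] (hM : M.NoUnd) (hv : ∃ u, u ≠ v) (W φ : H.V → ℤ)
    (hW : ∑ h, W h = 1) (hH : ∀ a b, H.adj a b → φ a = W a + φ b)
    (hin : ∀ u, M.Arc u v → φ (p (.inc, u)) = 0)
    (hout : ∀ w, M.Arc v w → φ (p (.out, w)) = W (p (.out, w)) - 1)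
    (htraversal : ∀ u w, M.Arc u v → M.Arc v w →
      HasTraversal H.adj (p (.inc, u)) (p (.out, w))) :
    (M.replace v H p).Ham ↔ M.Ham := by
  refine ⟨Ham.of_replace_of_weight hv W φ hW ?_ ?_ hH, Ham.replace ?_ (.inl fun w => hM v w)⟩
  · rintro ⟨_ | _ | _, u⟩ hu hk
    exacts [hin u hu, absurd rfl hk, absurd hu (hM _ _)]
  · rintro ⟨_ | _ | _, u⟩ hu hk
    exacts [absurd rfl hk, hout u hu, absurd hu (hM _ _)]
  · rintro ⟨_ | _ | _, u⟩ hu ⟨_ | _ | _, w⟩ hw - hku hkw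
    exacts [absurd rfl hkw, htraversal u w hu hw, absurd hw (hM _ _), absurd rfl hku,
      absurd rfl hku, absurd rfl hku, absurd hu (hM _ _), absurd hu (hM _ _), absurd hu (hM _ _)]

theorem exists_degree_le_replace {c : ℕ} (hv : c < M.degree v) (h : ∃ w, M.degree w ≤ c) :
    ∃ w, (M.replace v H p).degree w ≤ c := by
  obtain ⟨w, hw⟩ := h
  have hwv : w ≠ v := by
    rintro rfl
    exact hv.not_ge hw
  exact ⟨outer ⟨w, hwv⟩, (degree_outer _).trans_le hw⟩

end Replace

theorem kdeg_le_degree (M : MixedGraph) (k : Kind) (v : M.V) : M.kdeg k v ≤ M.degree v := by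
  rw [degree_eq_kdeg_add_kdeg_add_kdeg]
  cases k <;> omega

theorem exists_ne_of_degree_pos {M : MixedGraph} {v : M.V} (h : 0 < M.degree v) : ∃ u, u ≠ v := by
  obtain ⟨⟨k, u⟩, hu⟩ := (Set.ncard_pos (Set.toFinite _)).1 h
  exact ⟨u, fun h => not_mem_incident_self (h ▸ hu)⟩

theorem NoUnd.kdeg_inc_eq_card {M : MixedGraph} (hM : M.NoUnd) [Fintype M.V]
    [DecidableRel M.adj] (v : M.V) : M.kdeg .inc v = {u | M.adj u v}.toFinset.card := by
  rw [← Set.ncard_eq_toFinset_card', kdeg]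
  exact congrArg _ (Set.ext fun u => (or_iff_left (hM u v)).symm)

theorem NoUnd.kdeg_out_eq_card {M : MixedGraph} (hM : M.NoUnd) [Fintype M.V]
    [DecidableRel M.adj] (v : M.V) : M.kdeg .out v = {u | M.adj v u}.toFinset.card := by
  rw [← Set.ncard_eq_toFinset_card', kdeg]
  exact congrArg _ (Set.ext fun u => (or_iff_left (hM v u)).symm)

/-- What every step `M` to `M'` of the conversion preserves: Hamiltonicity and the presence of a
vertex of degree at most `c`. The latter matters for the bound by `sumMaxDegree`, to which an
isolated vertex contributes nothing. -/
structure Reduction (c : ℕ) (M M' : MixedGraph) : Prop where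
  ham_iff : M'.Ham ↔ M.Ham
  exists_degree_le : (∃ v, M.degree v ≤ c) → ∃ v, M'.degree v ≤ c

theorem Reduction.refl (c : ℕ) (M : MixedGraph) : Reduction c M M := ⟨.rfl, id⟩

theorem Reduction.trans {c : ℕ} {M M' M'' : MixedGraph} (h : Reduction c M M')
    (h' : Reduction c M' M'') : Reduction c M M'' :=
  ⟨h'.ham_iff.trans h.ham_iff, h'.exists_degree_le ∘ h.exists_degree_le⟩

end MixedGraph

namespace HCP

open MixedGraph

theorem split_noUnd : split.NoUnd := fun _ _ => id

theorem inSplit_noUnd : inSplit.NoUnd := fun _ _ => id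

theorem outSplit_noUnd : outSplit.NoUnd := fun _ _ => id

instance : Fintype split.V := inferInstanceAs (Fintype (Fin 2))

instance : DecidableEq split.V := inferInstanceAs (DecidableEq (Fin 2))

instance (i : ℕ) : OfNat split.V i := inferInstanceAs (OfNat (Fin 2) i)

instance : DecidableRel split.adj := fun a b =>
  inferInstanceAs (Decidable (((a, b) : Fin 2 × Fin 2) = (0, 1) ∨ False))

instance : Fintype inSplit.V := inferInstanceAs (Fintype (Fin 3))

instance : DecidableEq inSplit.V := inferInstanceAs (DecidableEq (Fin 3))

instance (i : ℕ) : OfNat inSplit.V i := inferInstanceAs (OfNat (Fin 3) i)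

instance : DecidableRel inSplit.adj := fun a b => inferInstanceAs <| Decidable <|
  ((a, b) : Fin 3 × Fin 3) ∈ ([(0, 1), (0, 2), (1, 0), (1, 2)] : List (Fin 3 × Fin 3)) ∨ False

instance : Fintype outSplit.V := inferInstanceAs (Fintype (Fin 3))

instance : DecidableEq outSplit.V := inferInstanceAs (DecidableEq (Fin 3))

instance (i : ℕ) : OfNat outSplit.V i := inferInstanceAs (OfNat (Fin 3) i)

instance : DecidableRel outSplit.adj := fun a b => inferInstanceAs <| Decidable <|
  ((a, b) : Fin 3 × Fin 3) ∈ ([(0, 1), (0, 2), (1, 2), (2, 1)] : List (Fin 3 × Fin 3)) ∨ False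

theorem split_kdeg :
    split.kdeg .inc 0 = 0 ∧ split.kdeg .inc 1 = 1 ∧
      split.kdeg .out 0 = 1 ∧ split.kdeg .out 1 = 0 := by
  simp only [split_noUnd.kdeg_inc_eq_card, split_noUnd.kdeg_out_eq_card]
  decide

theorem inSplit_kdeg :
    inSplit.kdeg .inc 0 = 1 ∧ inSplit.kdeg .inc 1 = 1 ∧ inSplit.kdeg .inc 2 = 2 ∧
      inSplit.kdeg .out 0 = 2 ∧ inSplit.kdeg .out 1 = 2 ∧ inSplit.kdeg .out 2 = 0 := by
  simp only [inSplit_noUnd.kdeg_inc_eq_card, inSplit_noUnd.kdeg_out_eq_card]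
  decide

theorem outSplit_kdeg :
    outSplit.kdeg .inc 0 = 0 ∧ outSplit.kdeg .inc 1 = 2 ∧ outSplit.kdeg .inc 2 = 2 ∧
      outSplit.kdeg .out 0 = 2 ∧ outSplit.kdeg .out 1 = 1 ∧ outSplit.kdeg .out 2 = 1 := by
  simp only [outSplit_noUnd.kdeg_inc_eq_card, outSplit_noUnd.kdeg_out_eq_card]
  decide

theorem split_hasTraversal : HasTraversal split.adj 0 1 :=
  hasTraversal_of_isChain (l := [0, 1]) (by decide) (by decide) (by decide) rfl rfl

theorem inSplit_hasTraversal {a : inSplit.V} (ha : a = 0 ∨ a = 1) :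
    HasTraversal inSplit.adj a 2 := by
  obtain rfl | rfl := ha
  · exact hasTraversal_of_isChain (l := [0, 1, 2]) (by decide) (by decide) (by decide) rfl rfl
  · exact hasTraversal_of_isChain (l := [1, 0, 2]) (by decide) (by decide) (by decide) rfl rfl

theorem outSplit_hasTraversal {b : outSplit.V} (hb : b = 1 ∨ b = 2) :
    HasTraversal outSplit.adj 0 b := by
  obtain rfl | rfl := hb
  · exact hasTraversal_of_isChain (l := [0, 2, 1]) (by decide) (by decide) (by decide) rfl rfl
  · exact hasTraversal_of_isChain (l := [0, 1, 2]) (by decide) (by decide) (by decide) rfl rfl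

section Replace

variable {M : MixedGraph} {v : M.V}

theorem ham_replace_split_iff {p : Kind × M.V → split.V} (hM : M.NoUnd) (hv : ∃ u, u ≠ v)
    (hin : ∀ u, M.Arc u v → p (.inc, u) = 0) (hout : ∀ w, M.Arc v w → p (.out, w) = 1) :
    (M.replace v split p).Ham ↔ M.Ham := by
  refine hM.ham_replace_iff hv (fun a => if a = 1 then 1 else 0) (fun _ => 0) (by decide)
    (by decide) (fun _ _ => rfl) (fun w hw => ?_) fun u w hu hw => ?_
  · simp [hout w hw]
  · rw [hin u hu, hout w hw]
    exact split_hasTraversal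

theorem ham_replace_inSplit_iff {p : Kind × M.V → inSplit.V} (hM : M.NoUnd) (hv : ∃ u, u ≠ v)
    (hin : ∀ u, M.Arc u v → p (.inc, u) = 0 ∨ p (.inc, u) = 1)
    (hout : ∀ w, M.Arc v w → p (.out, w) = 2) :
    (M.replace v inSplit p).Ham ↔ M.Ham := by
  refine hM.ham_replace_iff hv (fun a => if a = 2 then 1 else 0) (fun _ => 0) (by decide)
    (by decide) (fun _ _ => rfl) (fun w hw => ?_) fun u w hu hw => ?_
  · simp [hout w hw]
  · rw [hout w hw]
    exact inSplit_hasTraversal (hin u hu)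

theorem ham_replace_outSplit_iff {p : Kind × M.V → outSplit.V} (hM : M.NoUnd) (hv : ∃ u, u ≠ v)
    (hin : ∀ u, M.Arc u v → p (.inc, u) = 0)
    (hout : ∀ w, M.Arc v w → p (.out, w) = 1 ∨ p (.out, w) = 2) :
    (M.replace v outSplit p).Ham ↔ M.Ham := by
  refine hM.ham_replace_iff hv (fun a => if a = 0 then 1 else 0) (fun a => if a = 0 then 0 else -1)
    (by decide) (by decide) (fun u hu => ?_) (fun w hw => ?_) fun u w hu hw => ?_
  · simp [hin u hu]
  · obtain h | h := hout w hw <;> rw [h] <;> decide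
  · rw [hin u hu]
    exact outSplit_hasTraversal (hout w hw)

end Replace

open Classical in
/-- The sum over all vertices of a function of the in-degree, the out-degree, and whether the vertex
belongs to the marked part. -/
noncomputable def Marked.sum (A : Marked) (F : Bool → ℕ → ℕ → ℕ) : ℕ :=
  A.graph.total fun x => F (decide (x ∈ A.part)) (A.graph.kdeg .inc x) (A.graph.kdeg .out x)

open Classical in
theorem Marked.sum_replace (A : Marked) (v : A.graph.V) (H : MixedGraph)
    (p : Kind × A.graph.V → H.V) (F : Bool → ℕ → ℕ → ℕ) :
    (A.replace v H p).sum F +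
        F (decide (v ∈ A.part)) (A.graph.kdeg .inc v) (A.graph.kdeg .out v) =
      A.sum F + H.total fun h => F true (H.kdeg .inc h + attached p v .inc h)
        (H.kdeg .out h + attached p v .out h) := by
  let f (x : (A.graph.replace v H p).V) : ℕ := F (decide (x ∈ (A.replace v H p).part))
    ((A.graph.replace v H p).kdeg .inc x) ((A.graph.replace v H p).kdeg .out x)
  let g (x : A.graph.V) : ℕ :=
    F (decide (x ∈ A.part)) (A.graph.kdeg .inc x) (A.graph.kdeg .out x)
  have houter (w : {w : A.graph.V // w ≠ v}) : f (outer w) = g w := by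
    simp only [f, g, kdeg_outer]
    rfl
  have hinner (h : H.V) : f (inner h) = F true (H.kdeg .inc h + attached p v .inc h)
      (H.kdeg .out h + attached p v .out h) := by
    simp only [f, kdeg_inner]
    congr
    exact decide_eq_true trivial
  have hsum := total_replace houter
  simp only [hinner] at hsum
  exact hsum

theorem split_total (f : split.V → ℕ) : split.total f = f 0 + f 1 :=
  (total_eq_sum _ _).trans (Fin.sum_univ_two f)

theorem inSplit_total (f : inSplit.V → ℕ) : inSplit.total f = f 0 + f 1 + f 2 :=
  (total_eq_sum _ _).trans (Fin.sum_univ_three f)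

theorem outSplit_total (f : outSplit.V → ℕ) : outSplit.total f = f 0 + f 1 + f 2 :=
  (total_eq_sum _ _).trans (Fin.sum_univ_three f)

section Attached

variable {M : MixedGraph} {v : M.V}

theorem attached_split {p : Kind × M.V → split.V} (hin : ∀ u, M.Arc u v → p (.inc, u) = 0)
    (hout : ∀ w, M.Arc v w → p (.out, w) = 1) :
    attached p v .inc 0 = M.kdeg .inc v ∧ attached p v .inc 1 = 0 ∧
      attached p v .out 0 = 0 ∧ attached p v .out 1 = M.kdeg .out v :=
  ⟨attached_eq_kdeg hin, attached_eq_zero fun u hu => by rw [hin u hu]; decide,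
    attached_eq_zero fun w hw => by rw [hout w hw]; decide, attached_eq_kdeg hout⟩

theorem attached_inSplit {p : Kind × M.V → inSplit.V}
    (hin : ∀ u, M.Arc u v → p (.inc, u) = 0 ∨ p (.inc, u) = 1)
    (hout : ∀ w, M.Arc v w → p (.out, w) = 2) :
    attached p v .inc 0 + attached p v .inc 1 = M.kdeg .inc v ∧ attached p v .inc 2 = 0 ∧
      attached p v .out 0 = 0 ∧ attached p v .out 1 = 0 ∧ attached p v .out 2 = M.kdeg .out v :=
  ⟨attached_add_attached (by decide) hin,
    attached_eq_zero fun u hu => by obtain h | h := hin u hu <;> rw [h] <;> decide,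
    attached_eq_zero fun w hw => by rw [hout w hw]; decide,
    attached_eq_zero fun w hw => by rw [hout w hw]; decide, attached_eq_kdeg hout⟩

theorem attached_outSplit {p : Kind × M.V → outSplit.V}
    (hin : ∀ u, M.Arc u v → p (.inc, u) = 0)
    (hout : ∀ w, M.Arc v w → p (.out, w) = 1 ∨ p (.out, w) = 2) :
    attached p v .inc 0 = M.kdeg .inc v ∧ attached p v .inc 1 = 0 ∧ attached p v .inc 2 = 0 ∧
      attached p v .out 0 = 0 ∧ attached p v .out 1 + attached p v .out 2 = M.kdeg .out v :=
  ⟨attached_eq_kdeg hin, attached_eq_zero fun u hu => by rw [hin u hu]; decide,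
    attached_eq_zero fun u hu => by rw [hin u hu]; decide,
    attached_eq_zero fun w hw => by obtain h | h := hout w hw <;> rw [h] <;> decide,
    attached_add_attached (by decide) hout⟩

end Attached

theorem InitialSplit.sum_eq {M : MixedGraph} {v : M.V} {B : Marked} (h : InitialSplit M v B)
    (F : Bool → ℕ → ℕ → ℕ) :
    B.sum F + F false (M.kdeg .inc v) (M.kdeg .out v) =
      Marked.sum ⟨M, ∅⟩ F + (F true (M.kdeg .inc v) 1 + F true 1 (M.kdeg .out v)) := by
  classical
  obtain ⟨p, hin, hout, rfl⟩ := h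
  obtain ⟨i0, i1, o0, o1⟩ := split_kdeg
  obtain ⟨ai0, ai1, ao0, ao1⟩ := attached_split (p := p) hin hout
  have := Marked.sum_replace ⟨M, ∅⟩ v split p F
  simpa only [split_total, i0, i1, o0, o1, ai0, ai1, ao0, ao1, zero_add, add_zero,
    Set.mem_empty_iff_false, decide_false] using this

theorem InSplitStep.sum_eq {d : ℕ} {A B : Marked} (h : InSplitStep d A B) :
    ∃ n m a b, d < n ∧ n = a + b ∧ a ≤ b + 1 ∧ b ≤ a + 1 ∧ ∀ F : Bool → ℕ → ℕ → ℕ,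
      B.sum F + F true n m =
        A.sum F + (F true (1 + a) 2 + F true (1 + b) 2 + F true 2 m) := by
  classical
  obtain ⟨v, hv, p, hd, hin, hle, hge, hout, rfl⟩ := h
  obtain ⟨i0, i1, i2, o0, o1, o2⟩ := inSplit_kdeg
  obtain ⟨ai, ai2, ao0, ao1, ao2⟩ := attached_inSplit (p := p) hin hout
  refine ⟨A.graph.kdeg .inc v, A.graph.kdeg .out v, _, _, hd, ai.symm, hle, hge, fun F => ?_⟩
  have := Marked.sum_replace A v inSplit p F
  simpa only [inSplit_total, i0, i1, i2, o0, o1, o2, ai2, ao0, ao1, ao2, zero_add, add_zero,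
    hv, decide_true] using this

theorem OutSplitStep.sum_eq {d : ℕ} {A B : Marked} (h : OutSplitStep d A B) :
    ∃ n m a b, d < m ∧ m = a + b ∧ a ≤ b + 1 ∧ b ≤ a + 1 ∧ ∀ F : Bool → ℕ → ℕ → ℕ,
      B.sum F + F true n m =
        A.sum F + (F true n 2 + F true 2 (1 + a) + F true 2 (1 + b)) := by
  classical
  obtain ⟨v, hv, p, hd, hin, hout, hle, hge, rfl⟩ := h
  obtain ⟨i0, i1, i2, o0, o1, o2⟩ := outSplit_kdeg
  obtain ⟨ai0, ai1, ai2, ao0, ao⟩ := attached_outSplit (p := p) hin hout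
  refine ⟨A.graph.kdeg .inc v, A.graph.kdeg .out v, _, _, hd, ao.symm, hle, hge, fun F => ?_⟩
  have := Marked.sum_replace A v outSplit p F
  simpa only [outSplit_total, i0, i1, i2, o0, o1, o2, ai0, ai1, ai2, ao0, zero_add, add_zero,
    hv, decide_true] using this

/-! ### Termination and size of the Splitting Procedure -/

theorem inSplitStep_terminates {d : ℕ} (hd : 3 ≤ d) : LoopTerminates (InSplitStep d) := by
  refine .of_measure (fun A => A.sum fun b n _ => if b then n - 3 else 0) fun A B h => ?_
  obtain ⟨n, m, a, b, hn, hab, hle, hge, hsum⟩ := h.sum_eq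
  have := hsum fun b n _ => if b then n - 3 else 0
  simp only [if_true] at this
  omega

theorem outSplitStep_terminates {d : ℕ} (hd : 3 ≤ d) : LoopTerminates (OutSplitStep d) := by
  refine .of_measure (fun A => A.sum fun b _ n => if b then n - 3 else 0) fun A B h => ?_
  obtain ⟨n, m, a, b, hn, hab, hle, hge, hsum⟩ := h.sum_eq
  have := hsum fun b _ n => if b then n - 3 else 0
  simp only [if_true] at this
  omega

theorem exists_splittingProcedure {d : ℕ} (hd : 3 ≤ d) (M : MixedGraph) (v : M.V) :
    ∃ M', SplittingProcedure d M v M' := by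
  let p (x : Kind × M.V) : Fin 2 :=
    match x.1 with
    | .inc => 0
    | _ => 1
  obtain ⟨B, hB⟩ := (inSplitStep_terminates hd).exists_runLoop (Marked.replace ⟨M, ∅⟩ v split p)
  obtain ⟨C, hC⟩ := (outSplitStep_terminates hd).exists_runLoop B
  exact ⟨_, _, B, C, ⟨p, fun _ _ => rfl, fun _ _ => rfl, rfl⟩, hB, hC, rfl⟩

theorem kdeg_le_of_forall_not_splitStep {d : ℕ} (hd : 3 ≤ d) {A : MixedGraph}
    (h : ∀ B, ¬ SplitStep d A B) (v : A.V) : A.kdeg .inc v ≤ d ∧ A.kdeg .out v ≤ d := by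
  by_contra hv
  obtain ⟨B, hB⟩ := exists_splittingProcedure hd A v
  exact h B ⟨v, (not_and_or.1 hv).imp not_le.1 not_le.1, hB⟩

theorem kdeg_inc_le_of_forall_not_inSplitStep {d : ℕ} {A : Marked}
    (h : ∀ B, ¬ InSplitStep d A B) {v : A.graph.V} (hv : v ∈ A.part) :
    A.graph.kdeg .inc v ≤ d := by
  by_contra! hd
  obtain ⟨q, hq, hle, hge⟩ :=
    exists_balanced_map {u | A.graph.Arc u v} (by decide : (0 : Fin 3) ≠ 1)
  let p (x : Kind × A.graph.V) : Fin 3 :=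
    match x with
    | (.inc, u) => q u
    | _ => 2
  exact h _ ⟨v, hv, p, hd, fun u _ => hq u, hle, hge, fun _ _ => rfl, rfl⟩

theorem kdeg_out_le_of_forall_not_outSplitStep {d : ℕ} {A : Marked}
    (h : ∀ B, ¬ OutSplitStep d A B) {v : A.graph.V} (hv : v ∈ A.part) :
    A.graph.kdeg .out v ≤ d := by
  by_contra! hd
  obtain ⟨q, hq, hle, hge⟩ :=
    exists_balanced_map {w | A.graph.Arc v w} (by decide : (1 : Fin 3) ≠ 2)
  let p (x : Kind × A.graph.V) : Fin 3 :=
    match x with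
    | (.out, w) => q w
    | _ => 0
  exact h _ ⟨v, hv, p, hd, fun _ _ => rfl, fun w _ => hq w, hle, hge, rfl⟩

theorem OutSplitStep.kdeg_inc_le {d : ℕ} (hd : 2 ≤ d) {A B : Marked} (h : OutSplitStep d A B)
    (hA : ∀ v ∈ A.part, A.graph.kdeg .inc v ≤ d) : ∀ v ∈ B.part, B.graph.kdeg .inc v ≤ d := by
  obtain ⟨v, hv, p, -, hin, hout, -, -, rfl⟩ := h
  have hinner (h : outSplit.V) : outSplit.kdeg .inc h + attached p v .inc h ≤ d := by
    obtain ⟨i0, i1, i2, -⟩ := outSplit_kdeg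
    obtain ⟨ai0, ai1, ai2, -⟩ := attached_outSplit (p := p) hin hout
    have := hA v hv
    obtain rfl | rfl | rfl : h = 0 ∨ h = 1 ∨ h = 2 := by decide +revert
    all_goals omega
  intro x hx
  obtain ⟨w, rfl⟩ | ⟨h, rfl⟩ := outer_or_inner x
  · exact (kdeg_outer .inc w).trans_le (hA w hx)
  · exact (kdeg_inner .inc h).trans_le (hinner h)

/-- The number of vertices whose in-degree or out-degree is greater than `d`. -/
noncomputable def numBad (d : ℕ) (M : MixedGraph) : ℕ :=
  M.total fun v => if d < M.kdeg .inc v ∨ d < M.kdeg .out v then 1 else 0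

/-- The number of vertices outside the marked part whose in-degree or out-degree is greater
than `d`. -/
noncomputable def numUnmarkedBad (d : ℕ) (A : Marked) : ℕ :=
  A.sum fun b n m => if b then 0 else if d < n ∨ d < m then 1 else 0

theorem numBad_le_numUnmarkedBad {d : ℕ} {A : Marked}
    (h : ∀ v ∈ A.part, A.graph.kdeg .inc v ≤ d ∧ A.graph.kdeg .out v ≤ d) :
    numBad d A.graph ≤ numUnmarkedBad d A := by
  refine total_mono fun v => ?_
  by_cases hv : v ∈ A.part
  · simp [hv, h v hv]
  · simp [hv]

theorem InitialSplit.numUnmarkedBad_add_one {d : ℕ} {M : MixedGraph} {v : M.V} {B : Marked}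
    (hv : d < M.inDegree v ∨ d < M.outDegree v) (h : InitialSplit M v B) :
    numUnmarkedBad d B + 1 = numBad d M := by
  have hv : d < M.kdeg .inc v ∨ d < M.kdeg .out v := hv
  have := h.sum_eq fun b n m => if b then 0 else if d < n ∨ d < m then 1 else 0
  simpa [numUnmarkedBad, numBad, Marked.sum, hv] using this

theorem InSplitStep.numUnmarkedBad_eq {d : ℕ} {A B : Marked} (h : InSplitStep d A B) :
    numUnmarkedBad d B = numUnmarkedBad d A := by
  obtain ⟨n, m, a, b, -, -, -, -, hF⟩ := h.sum_eq
  exact hF fun b n m => if b then 0 else if d < n ∨ d < m then 1 else 0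

theorem OutSplitStep.numUnmarkedBad_eq {d : ℕ} {A B : Marked} (h : OutSplitStep d A B) :
    numUnmarkedBad d B = numUnmarkedBad d A := by
  obtain ⟨n, m, a, b, -, -, -, -, hF⟩ := h.sum_eq
  exact hF fun b n m => if b then 0 else if d < n ∨ d < m then 1 else 0

theorem SplittingProcedure.numBad_lt {d : ℕ} (hd : 2 ≤ d) {M M' : MixedGraph} {v : M.V}
    (hv : d < M.inDegree v ∨ d < M.outDegree v) (h : SplittingProcedure d M v M') :
    numBad d M' < numBad d M := by
  obtain ⟨A, B, C, hA, hB, hC, rfl⟩ := h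
  have hAB : numUnmarkedBad d B = numUnmarkedBad d A :=
    invariant_of_reflTransGen (P := fun X => numUnmarkedBad d X = numUnmarkedBad d A) hB.1 rfl
      fun _ _ h => h.numUnmarkedBad_eq.trans
  have hBC : numUnmarkedBad d C = numUnmarkedBad d B :=
    invariant_of_reflTransGen (P := fun X => numUnmarkedBad d X = numUnmarkedBad d B) hC.1 rfl
      fun _ _ h => h.numUnmarkedBad_eq.trans
  have hin : ∀ v ∈ C.part, C.graph.kdeg .inc v ≤ d :=
    invariant_of_reflTransGen (P := fun X => ∀ v ∈ X.part, X.graph.kdeg .inc v ≤ d) hC.1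
      (fun _ => kdeg_inc_le_of_forall_not_inSplitStep hB.2) fun _ _ h => h.kdeg_inc_le hd
  have hC : numBad d C.graph ≤ numUnmarkedBad d C := numBad_le_numUnmarkedBad fun v hv =>
    ⟨hin v hv, kdeg_out_le_of_forall_not_outSplitStep hC.2 hv⟩
  have := hA.numUnmarkedBad_add_one hv
  omega

theorem splitStep_terminates {d : ℕ} (hd : 2 ≤ d) : LoopTerminates (SplitStep d) :=
  .of_measure (numBad d) fun _ _ ⟨_, hv, h⟩ => h.numBad_lt hd hv

/-- An upper bound for the number of vertices after all further in-splits and out-splits. -/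
noncomputable def splitSize (M : MixedGraph) : ℕ :=
  M.total fun v => 1 + 2 * ((M.kdeg .inc v - 3) + (M.kdeg .out v - 3))

theorem InSplitStep.splitSize_le {d : ℕ} (hd : 3 ≤ d) {A B : Marked} (h : InSplitStep d A B) :
    splitSize B.graph ≤ splitSize A.graph := by
  obtain ⟨n, m, a, b, hn, hab, hle, hge, hsum⟩ := h.sum_eq
  have : splitSize B.graph + _ = splitSize A.graph + _ :=
    hsum fun _ n m => 1 + 2 * ((n - 3) + (m - 3))
  omega

theorem OutSplitStep.splitSize_le {d : ℕ} (hd : 3 ≤ d) {A B : Marked} (h : OutSplitStep d A B) :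
    splitSize B.graph ≤ splitSize A.graph := by
  obtain ⟨n, m, a, b, hn, hab, hle, hge, hsum⟩ := h.sum_eq
  have : splitSize B.graph + _ = splitSize A.graph + _ :=
    hsum fun _ n m => 1 + 2 * ((n - 3) + (m - 3))
  omega

theorem InitialSplit.splitSize_le {M : MixedGraph} {v : M.V} {B : Marked}
    (h : InitialSplit M v B) : splitSize B.graph ≤ splitSize M + 1 := by
  have : splitSize B.graph + _ = splitSize M + _ :=
    h.sum_eq fun _ n m => 1 + 2 * ((n - 3) + (m - 3))
  omega

theorem SplittingProcedure.splitSize_le {d : ℕ} (hd : 3 ≤ d) {M M' : MixedGraph} {v : M.V}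
    (h : SplittingProcedure d M v M') : splitSize M' ≤ splitSize M + 1 := by
  obtain ⟨A, B, C, hA, hB, hC, rfl⟩ := h
  have hB : splitSize B.graph ≤ splitSize M + 1 :=
    invariant_of_reflTransGen (P := fun X => splitSize X.graph ≤ splitSize M + 1) hB.1
      hA.splitSize_le fun _ _ h => (h.splitSize_le hd).trans
  exact invariant_of_reflTransGen (P := fun X => splitSize X.graph ≤ splitSize M + 1) hC.1
    hB fun _ _ h => (h.splitSize_le hd).trans

theorem card_le_splitSize_add_numBad {d : ℕ} (hd : 3 ≤ d) {M A : MixedGraph}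
    (h : ReflTransGen (SplitStep d) M A) : Nat.card A.V ≤ splitSize M + numBad d M := by
  have hsize : splitSize A + numBad d A ≤ splitSize M + numBad d M := by
    refine invariant_of_reflTransGen
      (P := fun X => splitSize X + numBad d X ≤ splitSize M + numBad d M) h le_rfl ?_
    rintro X Y ⟨v, hv, h⟩ hX
    have := h.numBad_lt (by omega) hv
    have := h.splitSize_le hd
    omega
  have hcard : A.total (fun _ => 1) ≤ splitSize A := total_mono fun v => by omega
  rw [total_const] at hcard
  omega

/-! ### Correctness of the Splitting Procedure -/

/-- A reduction of graphs without undirected edges that keeps isolated vertices. -/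
def DirectedReduction (M M' : MixedGraph) : Prop := M.NoUnd → M'.NoUnd ∧ Reduction 0 M M'

theorem DirectedReduction.trans {M M' M'' : MixedGraph} (h : DirectedReduction M M')
    (h' : DirectedReduction M' M'') : DirectedReduction M M'' := fun hM =>
  have ⟨hM', h⟩ := h hM
  have ⟨hM'', h'⟩ := h' hM'
  ⟨hM'', h.trans h'⟩

theorem DirectedReduction.replace {M : MixedGraph} {v : M.V} {H : MixedGraph}
    {p : Kind × M.V → H.V} {k : Kind} (hv : 0 < M.kdeg k v) (hH : H.NoUnd)
    (hham : M.NoUnd → (∃ u, u ≠ v) → ((M.replace v H p).Ham ↔ M.Ham)) :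
    DirectedReduction M (M.replace v H p) := fun hM =>
  have hv : 0 < M.degree v := hv.trans_le (M.kdeg_le_degree k v)
  ⟨hM.replace hH, hham hM (exists_ne_of_degree_pos hv), exists_degree_le_replace hv⟩

theorem InitialSplit.directedReduction {M : MixedGraph} {v : M.V} {B : Marked} {k : Kind}
    (hv : 0 < M.kdeg k v) (h : InitialSplit M v B) : DirectedReduction M B.graph := by
  obtain ⟨p, hin, hout, rfl⟩ := h
  exact .replace hv split_noUnd fun hM hv => ham_replace_split_iff hM hv hin hout

theorem InSplitStep.directedReduction {d : ℕ} {A B : Marked} (h : InSplitStep d A B) :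
    DirectedReduction A.graph B.graph := by
  obtain ⟨v, -, p, hd, hin, -, -, hout, rfl⟩ := h
  exact .replace (k := .inc) (Nat.zero_lt_of_lt hd) inSplit_noUnd
    fun hM hv => ham_replace_inSplit_iff hM hv hin hout

theorem OutSplitStep.directedReduction {d : ℕ} {A B : Marked} (h : OutSplitStep d A B) :
    DirectedReduction A.graph B.graph := by
  obtain ⟨v, -, p, hd, hin, hout, -, -, rfl⟩ := h
  exact .replace (k := .out) (Nat.zero_lt_of_lt hd) outSplit_noUnd
    fun hM hv => ham_replace_outSplit_iff hM hv hin hout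

theorem SplitStep.directedReduction {d : ℕ} {M M' : MixedGraph} (h : SplitStep d M M') :
    DirectedReduction M M' := by
  obtain ⟨v, hv, A, B, C, hA, hB, hC, rfl⟩ := h
  have hA : DirectedReduction M A.graph := hv.elim
    (fun hv => hA.directedReduction (k := .inc) (Nat.zero_lt_of_lt hv))
    fun hv => hA.directedReduction (k := .out) (Nat.zero_lt_of_lt hv)
  have hB : DirectedReduction M B.graph :=
    invariant_of_reflTransGen (P := fun X => DirectedReduction M X.graph) hB.1 hA
      fun _ _ h hX => hX.trans h.directedReduction
  exact invariant_of_reflTransGen (P := fun X => DirectedReduction M X.graph) hC.1 hB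
    fun _ _ h hX => hX.trans h.directedReduction

theorem directedReduction_of_splitSteps {d : ℕ} {M A : MixedGraph}
    (h : ReflTransGen (SplitStep d) M A) : DirectedReduction M A :=
  invariant_of_reflTransGen (P := DirectedReduction M) h (fun hM => ⟨hM, .refl 0 M⟩)
    fun _ _ h hX => hX.trans h.directedReduction

end HCP

namespace MixedGraph

/-! ### Undirected graphs -/

/-- All edges of the graph are undirected. -/
def NoArc (M : MixedGraph) : Prop := ∀ x y, ¬ M.Arc x y

namespace NoArc

variable {M H : MixedGraph}

theorem adj_iff (hM : M.NoArc) {x y : M.V} : M.adj x y ↔ M.edge.Adj x y :=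
  or_iff_right (hM x y)

theorem adj_symm (hM : M.NoArc) (x y : M.V) (h : M.adj x y) : M.adj y x :=
  .inr (hM.adj_iff.1 h).symm

theorem replace (hM : M.NoArc) (hH : H.NoArc) {v : M.V} {p : Kind × M.V → H.V} :
    (M.replace v H p).NoArc := by
  rintro (a | a) (b | b) h
  exacts [hM _ _ h, hM _ _ h.1, hM _ _ h.1, hH _ _ h]

theorem degree_eq (hM : M.NoArc) (v : M.V) : M.degree v = (M.edge.neighborSet v).ncard := by
  have hinc : M.kdeg .inc v = 0 :=
    (Set.ncard_eq_zero (Set.toFinite _)).2 <| Set.eq_empty_iff_forall_notMem.2 fun _ => hM _ _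
  have hout : M.kdeg .out v = 0 :=
    (Set.ncard_eq_zero (Set.toFinite _)).2 <| Set.eq_empty_iff_forall_notMem.2 fun _ => hM _ _
  rw [degree_eq_kdeg_add_kdeg_add_kdeg, hinc, hout, zero_add, zero_add]
  rfl

theorem degree_le_length (hM : M.NoArc) {v : M.V} {l : List M.V}
    (h : ∀ u, M.adj v u → u ∈ l) : M.degree v ≤ l.length := by
  classical
  have hsub : M.edge.neighborSet v ⊆ (l.toFinset : Set M.V) := fun u hu =>
    List.mem_toFinset.2 (h u (.inr hu))
  rw [hM.degree_eq]
  exact (Set.ncard_le_ncard hsub).trans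
    ((Set.ncard_coe_finset _).trans_le (List.toFinset_card_le l))

end NoArc

end MixedGraph

/-! ### Traversals of gates -/

/-- The list `l` is a walk from `a` to `b` along the relation `R`. -/
structure IsWalk {V : Type*} (R : V → V → Prop) (l : List V) (a b : V) : Prop where
  isChain : l.IsChain R
  head?_eq : l.head? = some a
  getLast?_eq : l.getLast? = some b

theorem IsWalk.append {V : Type*} {R : V → V → Prop} {l₁ l₂ : List V} {a b c e : V}
    (h₁ : IsWalk R l₁ a b) (h : R b c) (h₂ : IsWalk R l₂ c e) : IsWalk R (l₁ ++ l₂) a e where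
  isChain := by
    refine List.isChain_append.2 ⟨h₁.isChain, h₂.isChain, ?_⟩
    rw [h₁.getLast?_eq, h₂.head?_eq]
    simpa using h
  head?_eq := by simp [h₁.head?_eq]
  getLast?_eq := by simp [h₂.getLast?_eq]

theorem IsWalk.reverse {V : Type*} {R : V → V → Prop} (hR : ∀ a b, R a b → R b a)
    {l : List V} {a b : V} (h : IsWalk R l a b) : IsWalk R l.reverse b a where
  isChain := List.isChain_reverse.2 (h.isChain.imp hR)
  head?_eq := by simpa using h.getLast?_eq
  getLast?_eq := by simpa using h.head?_eq

theorem IsWalk.map {V W : Type*} {R : V → V → Prop} {S : W → W → Prop} {f : V → W}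
    (hf : ∀ a b, R a b → S (f a) (f b)) {l : List V} {a b : V} (h : IsWalk R l a b) :
    IsWalk S (l.map f) (f a) (f b) where
  isChain := (List.isChain_map f).2 (h.isChain.imp hf)
  head?_eq := by simp [h.head?_eq]
  getLast?_eq := by simp [h.getLast?_eq]

theorem IsWalk.hasTraversal {V : Type*} [Fintype V] {R : V → V → Prop} {l : List V} {a b : V}
    (h : IsWalk R l a b) (hmem : ∀ v, v ∈ l) (hlen : l.length = Fintype.card V) :
    HasTraversal R a b := by
  classical
  have huniv : l.toFinset = Finset.univ :=
    Finset.eq_univ_of_forall fun z => List.mem_toFinset.2 (hmem z)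
  have hnodup : l.Nodup := by
    rw [← List.dedup_eq_self]
    refine (List.dedup_sublist l).eq_of_length ?_
    rw [← List.card_toFinset, huniv, Finset.card_univ, hlen]
  exact hasTraversal_of_isChain h.isChain hnodup hmem h.head?_eq h.getLast?_eq

namespace HCP

open MixedGraph

section Gate

variable {s : ℕ}

instance : Fintype (gate s).V := inferInstanceAs (Fintype (Fin 10 ⊕ Fin (2 * s - 7)))

theorem card_gate (s : ℕ) : Fintype.card (gate s).V = 10 + (2 * s - 7) := by
  change Fintype.card (Fin 10 ⊕ Fin (2 * s - 7)) = _
  rw [Fintype.card_sum, Fintype.card_fin, Fintype.card_fin]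

/-- The vertex of the `s`-gate with the label `a + 1`. -/
def top (a : Fin 10) : (gate s).V := (Sum.inl a : Fin 10 ⊕ Fin (2 * s - 7))

/-- The `j`-th vertex of the bottom row of the `s`-gate, counted from `0`. For `j ≥ 2 * s - 7`
there is none and the value is the vertex `top 0`. -/
def row (s j : ℕ) : (gate s).V :=
  if h : j < 2 * s - 7 then (Sum.inr ⟨j, h⟩ : Fin 10 ⊕ Fin (2 * s - 7)) else top 0

theorem row_of_lt {j : ℕ} (hj : j < 2 * s - 7) :
    row s j = (Sum.inr ⟨j, hj⟩ : Fin 10 ⊕ Fin (2 * s - 7)) := dif_pos hj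

theorem top_injective : Function.Injective (top (s := s)) := Sum.inl_injective

theorem top_or_row (x : (gate s).V) : (∃ a, x = top a) ∨ ∃ j < 2 * s - 7, x = row s j := by
  obtain a | ⟨j, hj⟩ := x
  exacts [.inl ⟨a, rfl⟩, .inr ⟨j, hj, (row_of_lt hj).symm⟩]

theorem total_gate (f : (gate s).V → ℕ) :
    (gate s).total f = ∑ a, f (top a) + ∑ j : Fin (2 * s - 7), f (row s j) := by
  rw [total_eq_sum]
  simp only [row_of_lt (Fin.is_lt _)]
  exact Fintype.sum_sum_type f

theorem gate_noArc : (gate s).NoArc := fun _ _ => id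

theorem gate_adj_iff {x y : (gate s).V} :
    (gate s).adj x y ↔ x ≠ y ∧ (gateRel s x y ∨ gateRel s y x) :=
  ⟨fun h => h.resolve_left id, Or.inr⟩

theorem gate_adj_symm (x y : (gate s).V) : (gate s).adj x y → (gate s).adj y x :=
  gate_noArc.adj_symm x y

/-- The labels of the neighbours of `top a` outside the bottom row. -/
def topNeighbors : Fin 10 → List (Fin 10) :=
  ![[2, 7], [2, 4], [0, 1, 3], [2, 4, 5], [1, 3], [3, 6], [5, 7, 9], [0, 6, 8], [7, 9], [6, 8]]

theorem gate_adj_top_top {a b : Fin 10} :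
    (gate s).adj (top a) (top b) ↔ b ∈ topNeighbors a := by
  have htop : ∀ a b : Fin 10, (a ≠ b ∧
      ((a.val + 1, b.val + 1) ∈ ([(1, 3), (1, 8), (2, 3), (2, 5), (3, 4), (4, 5), (4, 6), (6, 7),
          (7, 8), (7, 10), (8, 9), (9, 10)] : List (ℕ × ℕ)) ∨
        (b.val + 1, a.val + 1) ∈ ([(1, 3), (1, 8), (2, 3), (2, 5), (3, 4), (4, 5), (4, 6), (6, 7),
          (7, 8), (7, 10), (8, 9), (9, 10)] : List (ℕ × ℕ)))) ↔ b ∈ topNeighbors a := by decide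
  rw [← htop, gate_adj_iff, top_injective.ne_iff]
  rfl

theorem gate_adj_top_row {a : Fin 10} {j : ℕ} (hj : j < 2 * s - 7) :
    (gate s).adj (top a) (row s j) ↔
      (a = 4 ∧ j = 0) ∨ (a = 9 ∧ j + 1 = 2 * s - 7) ∨ (a = 0 ∧ Odd j) := by
  have h : (gate s).adj (top a) (row s j) ↔ (a.val + 1 = 5 ∧ j = 0) ∨
      (a.val + 1 = 10 ∧ j + 1 = 2 * s - 7) ∨ (a.val + 1 = 1 ∧ Odd j) := by
    rw [gate_adj_iff, row_of_lt hj]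
    exact ⟨fun h => h.2.resolve_right id, fun h => ⟨Sum.inl_ne_inr, .inl h⟩⟩
  rw [h]
  simp only [Fin.ext_iff]
  simp

theorem gate_adj_row_row {j k : ℕ} (hj : j < 2 * s - 7) (hk : k < 2 * s - 7) :
    (gate s).adj (row s j) (row s k) ↔ j + 1 = k ∨ k + 1 = j := by
  rw [gate_adj_iff, row_of_lt hj, row_of_lt hk]
  refine ⟨fun h => h.2, fun h => ⟨fun hjk => ?_, h⟩⟩
  have := Fin.mk.inj (Sum.inr_injective hjk)
  omega

theorem top_mem_gateExternal {a : Fin 10} : top a ∈ gateExternal s ↔ a = 0 ∨ a = 1 ∨ a = 8 :=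
  (by decide : ∀ a : Fin 10, (a.val + 1 = 1 ∨ a.val + 1 = 2 ∨ a.val + 1 = 9) ↔
    a = 0 ∨ a = 1 ∨ a = 8) a

theorem row_mem_gateExternal {j : ℕ} (hj : j < 2 * s - 7) :
    row s j ∈ gateExternal s ↔ Even j := by
  rw [row_of_lt hj]
  rfl

theorem gate_adj_four_row (hs : 4 ≤ s) : (gate s).adj (top 4) (row s 0) :=
  (gate_adj_top_row (by omega)).2 (.inl ⟨rfl, rfl⟩)

theorem gate_adj_nine_row (hs : 4 ≤ s) : (gate s).adj (top 9) (row s (2 * s - 7 - 1)) :=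
  (gate_adj_top_row (by omega)).2 (.inr (.inl ⟨rfl, by omega⟩))

theorem gate_adj_zero_row {j : ℕ} (hj : j < 2 * s - 7) (ho : Odd j) :
    (gate s).adj (top 0) (row s j) :=
  (gate_adj_top_row hj).2 (.inr (.inr ⟨rfl, ho⟩))

/-- The part of the bottom row from its vertex `a` to its vertex `b - 1`. -/
def rowUp (s a b : ℕ) : List (gate s).V := (List.range' a (b - a)).map (row s)

/-- The part of the bottom row from its vertex `b - 1` back to its vertex `a`. -/
def rowDown (s a b : ℕ) : List (gate s).V := (rowUp s a b).reverse

theorem isWalk_rowUp {a b : ℕ} (hab : a < b) (hb : b ≤ 2 * s - 7) :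
    IsWalk (gate s).adj (rowUp s a b) (row s a) (row s (b - 1)) := by
  obtain ⟨n, rfl⟩ : ∃ n, b = a + n + 1 := ⟨b - a - 1, by omega⟩
  have hn : a + n + 1 - a = n + 1 := by omega
  rw [rowUp, hn]
  refine ⟨(List.isChain_map _).2 ?_, by simp [List.range'_succ], by simp [List.range'_concat]⟩
  refine (List.isChain_range' a (n + 1) 1).imp_of_mem_imp fun x y hx hy hxy => ?_
  rw [List.mem_range'_1] at hx hy
  exact (gate_adj_row_row (by omega) (by omega)).2 (.inl hxy.symm)

theorem isWalk_rowDown {a b : ℕ} (hab : a < b) (hb : b ≤ 2 * s - 7) :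
    IsWalk (gate s).adj (rowDown s a b) (row s (b - 1)) (row s a) :=
  (isWalk_rowUp hab hb).reverse gate_adj_symm

theorem isWalk_top {l : List (Fin 10)} {a b : Fin 10}
    (hl : l.IsChain fun a b => b ∈ topNeighbors a) (ha : l.head? = some a)
    (hb : l.getLast? = some b) : IsWalk (gate s).adj (l.map top) (top a) (top b) :=
  IsWalk.map (f := top) (fun _ _ => gate_adj_top_top.2) ⟨hl, ha, hb⟩

theorem length_rowUp (s a b : ℕ) : (rowUp s a b).length = b - a := by simp [rowUp]

theorem length_rowDown (s a b : ℕ) : (rowDown s a b).length = b - a := by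
  rw [rowDown, List.length_reverse, length_rowUp]

theorem row_mem_rowUp {a b j : ℕ} (h : a ≤ j ∧ j < b) : row s j ∈ rowUp s a b :=
  List.mem_map_of_mem (List.mem_range'_1.2 ⟨h.1, by omega⟩)

theorem row_mem_rowDown {a b j : ℕ} (h : a ≤ j ∧ j < b) : row s j ∈ rowDown s a b :=
  List.mem_reverse.2 (row_mem_rowUp h)

theorem hasTraversal_gate_of_isWalk {l : List (gate s).V} {x y : (gate s).V}
    (h : IsWalk (gate s).adj l x y) (htop : ∀ a, top a ∈ l) (hrow : ∀ j < 2 * s - 7, row s j ∈ l)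
    (hlen : l.length = 10 + (2 * s - 7)) : HasTraversal (gate s).adj x y := by
  refine h.hasTraversal (fun v => ?_) (hlen.trans (card_gate s).symm)
  obtain ⟨a, rfl⟩ | ⟨j, hj, rfl⟩ := top_or_row v
  exacts [htop a, hrow j hj]

theorem hasTraversal_gate_zero_one (hs : 4 ≤ s) :
    HasTraversal (gate s).adj (top 0) (top 1) := by
  refine hasTraversal_gate_of_isWalk (l := [0, 2, 3, 5, 6, 7, 8, 9].map top ++
    (rowDown s 0 (2 * s - 7) ++ [4, 1].map top)) ?_ (fun a => ?_) (fun j hj => ?_) ?_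
  · exact (isWalk_top (by decide) rfl rfl).append (gate_adj_nine_row hs) <|
      (isWalk_rowDown (by omega) le_rfl).append (gate_adj_symm _ _ (gate_adj_four_row hs)) <|
      isWalk_top (by decide) rfl rfl
  · fin_cases a <;> simp
  · grind [row_mem_rowDown]
  · simp only [List.length_append, List.length_map, length_rowDown, List.length_cons,
      List.length_nil]
    omega

theorem hasTraversal_gate_zero_eight (hs : 4 ≤ s) :
    HasTraversal (gate s).adj (top 0) (top 8) := by
  refine hasTraversal_gate_of_isWalk (l := [0, 7, 6, 5, 3, 2, 1, 4].map top ++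
    (rowUp s 0 (2 * s - 7) ++ [9, 8].map top)) ?_ (fun a => ?_) (fun j hj => ?_) ?_
  · exact (isWalk_top (by decide) rfl rfl).append (gate_adj_four_row hs) <|
      (isWalk_rowUp (by omega) le_rfl).append (gate_adj_symm _ _ (gate_adj_nine_row hs)) <|
      isWalk_top (by decide) rfl rfl
  · fin_cases a <;> simp
  · grind [row_mem_rowUp]
  · simp only [List.length_append, List.length_map, length_rowUp, List.length_cons,
      List.length_nil]
    omega

theorem hasTraversal_gate_one_eight (hs : 4 ≤ s) :
    HasTraversal (gate s).adj (top 1) (top 8) := by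
  refine hasTraversal_gate_of_isWalk (l := [1, 4].map top ++
    (rowUp s 0 (2 * s - 7) ++ [9, 6, 5, 3, 2, 0, 7, 8].map top)) ?_ (fun a => ?_)
    (fun j hj => ?_) ?_
  · exact (isWalk_top (by decide) rfl rfl).append (gate_adj_four_row hs) <|
      (isWalk_rowUp (by omega) le_rfl).append (gate_adj_symm _ _ (gate_adj_nine_row hs)) <|
      isWalk_top (by decide) rfl rfl
  · fin_cases a <;> simp
  · grind [row_mem_rowUp]
  · simp only [List.length_append, List.length_map, length_rowUp, List.length_cons,
      List.length_nil]
    omega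

theorem hasTraversal_gate_zero_row (hs : 4 ≤ s) {i : ℕ} (hi : i < 2 * s - 7) (he : Even i) :
    HasTraversal (gate s).adj (top 0) (row s i) := by
  obtain rfl | hi0 := i.eq_zero_or_pos
  · refine hasTraversal_gate_of_isWalk (l := [0, 2, 1, 4, 3, 5, 6, 7, 8, 9].map top ++
      rowDown s 0 (2 * s - 7)) ?_ (fun a => ?_) (fun j hj => ?_) ?_
    · exact (isWalk_top (by decide) rfl rfl).append (gate_adj_nine_row hs)
        (isWalk_rowDown (by omega) le_rfl)
    · fin_cases a <;> simp
    · grind [row_mem_rowDown]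
    · simp only [List.length_append, List.length_map, length_rowDown, List.length_cons,
        List.length_nil]
      omega
  · have ho : Odd (i - 1) := Nat.Even.sub_odd hi0 he odd_one
    refine hasTraversal_gate_of_isWalk (l := [0].map top ++ (rowDown s 0 i ++
      ([4, 1, 2, 3, 5, 6, 7, 8, 9].map top ++ rowDown s i (2 * s - 7)))) ?_ (fun a => ?_)
      (fun j hj => ?_) ?_
    · exact (isWalk_top (by decide) rfl rfl).append (gate_adj_zero_row (by omega) ho) <|
        (isWalk_rowDown hi0 hi.le).append (gate_adj_symm _ _ (gate_adj_four_row hs)) <|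
        (isWalk_top (by decide) rfl rfl).append (gate_adj_nine_row hs) <|
        isWalk_rowDown (by omega) le_rfl
    · fin_cases a <;> simp
    · grind [row_mem_rowDown]
    · simp only [List.length_append, List.length_map, length_rowDown, List.length_cons,
        List.length_nil]
      omega

theorem hasTraversal_gate_one_row (hs : 4 ≤ s) {i : ℕ} (hi : i < 2 * s - 7) (he : Even i) :
    HasTraversal (gate s).adj (top 1) (row s i) := by
  obtain rfl | hi1 := eq_or_ne i (2 * s - 7 - 1)
  · refine hasTraversal_gate_of_isWalk (l := [1, 2, 0, 7, 8, 9, 6, 5, 3, 4].map top ++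
      rowUp s 0 (2 * s - 7)) ?_ (fun a => ?_) (fun j hj => ?_) ?_
    · exact (isWalk_top (by decide) rfl rfl).append (gate_adj_four_row hs)
        (isWalk_rowUp (by omega) le_rfl)
    · fin_cases a <;> simp
    · grind [row_mem_rowUp]
    · simp only [List.length_append, List.length_map, length_rowUp, List.length_cons,
        List.length_nil]
      omega
  · refine hasTraversal_gate_of_isWalk (l := [1, 2, 0].map top ++ (rowUp s (i + 1) (2 * s - 7) ++
      ([9, 8, 7, 6, 5, 3, 4].map top ++ rowUp s 0 (i + 1)))) ?_ (fun a => ?_) (fun j hj => ?_) ?_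
    · exact (isWalk_top (by decide) rfl rfl).append (gate_adj_zero_row (by omega) he.add_one) <|
        (isWalk_rowUp (by omega) le_rfl).append (gate_adj_symm _ _ (gate_adj_nine_row hs)) <|
        (isWalk_top (by decide) rfl rfl).append (gate_adj_four_row hs) <|
        isWalk_rowUp (by omega) hi
    · fin_cases a <;> simp
    · grind [row_mem_rowUp]
    · simp only [List.length_append, List.length_map, length_rowUp, List.length_cons,
        List.length_nil]
      omega

theorem hasTraversal_gate_eight_row (hs : 4 ≤ s) {i : ℕ} (hi : i < 2 * s - 7) (he : Even i) :
    HasTraversal (gate s).adj (top 8) (row s i) := by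
  obtain rfl | hi0 := i.eq_zero_or_pos
  · refine hasTraversal_gate_of_isWalk (l := [8, 7, 0, 2, 1, 4, 3, 5, 6, 9].map top ++
      rowDown s 0 (2 * s - 7)) ?_ (fun a => ?_) (fun j hj => ?_) ?_
    · exact (isWalk_top (by decide) rfl rfl).append (gate_adj_nine_row hs)
        (isWalk_rowDown (by omega) le_rfl)
    · fin_cases a <;> simp
    · grind [row_mem_rowDown]
    · simp only [List.length_append, List.length_map, length_rowDown, List.length_cons,
        List.length_nil]
      omega
  · have ho : Odd (i - 1) := Nat.Even.sub_odd hi0 he odd_one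
    refine hasTraversal_gate_of_isWalk (l := [8, 7, 0].map top ++ (rowDown s 0 i ++
      ([4, 1, 2, 3, 5, 6, 9].map top ++ rowDown s i (2 * s - 7)))) ?_ (fun a => ?_)
      (fun j hj => ?_) ?_
    · exact (isWalk_top (by decide) rfl rfl).append (gate_adj_zero_row (by omega) ho) <|
        (isWalk_rowDown hi0 hi.le).append (gate_adj_symm _ _ (gate_adj_four_row hs)) <|
        (isWalk_top (by decide) rfl rfl).append (gate_adj_nine_row hs) <|
        isWalk_rowDown (by omega) le_rfl
    · fin_cases a <;> simp
    · grind [row_mem_rowDown]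
    · simp only [List.length_append, List.length_map, length_rowDown, List.length_cons,
        List.length_nil]
      omega

theorem hasTraversal_gate_row_row (hs : 4 ≤ s) {i k : ℕ} (hik : i < k) (hk : k < 2 * s - 7)
    (hi : Even i) (hke : Even k) : HasTraversal (gate s).adj (row s i) (row s k) := by
  have hko : Odd (k - 1) := Nat.Even.sub_odd (by omega) hke odd_one
  obtain rfl | hi0 := i.eq_zero_or_pos
  · refine hasTraversal_gate_of_isWalk (l := rowUp s 0 k ++
      ([0, 2, 1, 4, 3, 5, 6, 7, 8, 9].map top ++ rowDown s k (2 * s - 7))) ?_ (fun a => ?_)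
      (fun j hj => ?_) ?_
    · exact (isWalk_rowUp hik hk.le).append
        (gate_adj_symm _ _ (gate_adj_zero_row (by omega) hko)) <|
        (isWalk_top (by decide) rfl rfl).append (gate_adj_nine_row hs) <|
        isWalk_rowDown (by omega) le_rfl
    · fin_cases a <;> simp
    · grind [row_mem_rowUp, row_mem_rowDown]
    · simp only [List.length_append, List.length_map, length_rowUp, length_rowDown,
        List.length_cons, List.length_nil]
      omega
  · have hio : Odd (i - 1) := Nat.Even.sub_odd hi0 hi odd_one
    refine hasTraversal_gate_of_isWalk (l := rowUp s i k ++ ([0].map top ++ (rowDown s 0 i ++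
      ([4, 1, 2, 3, 5, 6, 7, 8, 9].map top ++ rowDown s k (2 * s - 7))))) ?_ (fun a => ?_)
      (fun j hj => ?_) ?_
    · exact (isWalk_rowUp hik hk.le).append
        (gate_adj_symm _ _ (gate_adj_zero_row (by omega) hko)) <|
        (isWalk_top (by decide) rfl rfl).append (gate_adj_zero_row (by omega) hio) <|
        (isWalk_rowDown hi0 (by omega)).append (gate_adj_symm _ _ (gate_adj_four_row hs)) <|
        (isWalk_top (by decide) rfl rfl).append (gate_adj_nine_row hs) <|
        isWalk_rowDown (by omega) le_rfl
    · fin_cases a <;> simp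
    · grind [row_mem_rowUp, row_mem_rowDown]
    · simp only [List.length_append, List.length_map, length_rowUp, length_rowDown,
        List.length_cons, List.length_nil]
      omega

theorem mem_gateExternal_cases {x : (gate s).V} (hx : x ∈ gateExternal s) :
    x = top 0 ∨ x = top 1 ∨ x = top 8 ∨ ∃ i < 2 * s - 7, Even i ∧ x = row s i := by
  obtain ⟨a, rfl⟩ | ⟨i, hi, rfl⟩ := top_or_row x
  · obtain rfl | rfl | rfl := top_mem_gateExternal.1 hx <;> simp
  · exact .inr (.inr (.inr ⟨i, hi, (row_mem_gateExternal hi).1 hx, rfl⟩))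

theorem hasTraversal_gate (hs : 4 ≤ s) {x y : (gate s).V} (hx : x ∈ gateExternal s)
    (hy : y ∈ gateExternal s) (hxy : x ≠ y) : HasTraversal (gate s).adj x y := by
  have symm {a b} : HasTraversal (gate s).adj a b → HasTraversal (gate s).adj b a :=
    .symm gate_adj_symm
  obtain rfl | rfl | rfl | ⟨i, hi, hie, rfl⟩ := mem_gateExternal_cases hx <;>
    obtain rfl | rfl | rfl | ⟨k, hk, hke, rfl⟩ := mem_gateExternal_cases hy
  · exact absurd rfl hxy
  · exact hasTraversal_gate_zero_one hs
  · exact hasTraversal_gate_zero_eight hs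
  · exact hasTraversal_gate_zero_row hs hk hke
  · exact symm (hasTraversal_gate_zero_one hs)
  · exact absurd rfl hxy
  · exact hasTraversal_gate_one_eight hs
  · exact hasTraversal_gate_one_row hs hk hke
  · exact symm (hasTraversal_gate_zero_eight hs)
  · exact symm (hasTraversal_gate_one_eight hs)
  · exact absurd rfl hxy
  · exact hasTraversal_gate_eight_row hs hk hke
  · exact symm (hasTraversal_gate_zero_row hs hi hie)
  · exact symm (hasTraversal_gate_one_row hs hi hie)
  · exact symm (hasTraversal_gate_eight_row hs hi hie)
  · obtain h | rfl | h := lt_trichotomy i k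
    · exact hasTraversal_gate_row_row hs h hk hie hke
    · exact absurd rfl hxy
    · exact symm (hasTraversal_gate_row_row hs h hi hke hie)

/-! ### Replacement of vertices by gates -/

/-- A proper `2`-colouring of the `s`-gate in which all external edges are at vertices of the colour
`1` and this colour class is the larger one, by one vertex. -/
def gateColor (s : ℕ) : (gate s).V → ℤ :=
  Sum.elim ![1, 1, 0, 1, 0, 0, 1, 0, 1, 0] fun j : Fin (2 * s - 7) => if Even j.val then 1 else 0

theorem gateColor_top (a : Fin 10) :
    gateColor s (top a) = ![1, 1, 0, 1, 0, 0, 1, 0, 1, 0] a := rfl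

theorem gateColor_row {j : ℕ} (hj : j < 2 * s - 7) :
    gateColor s (row s j) = if Even j then 1 else 0 := by
  rw [row_of_lt hj]
  rfl

theorem gateColor_top_add_row (hs : 4 ≤ s) {a : Fin 10} {j : ℕ} (hj : j < 2 * s - 7)
    (h : (gate s).adj (top a) (row s j)) : gateColor s (top a) + gateColor s (row s j) = 1 := by
  rw [gateColor_top, gateColor_row hj]
  obtain ⟨rfl, rfl⟩ | ⟨rfl, hlast⟩ | ⟨rfl, hodd⟩ := (gate_adj_top_row hj).1 h
  · rfl
  · rw [if_pos ⟨s - 4, by omega⟩]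
    rfl
  · rw [if_neg (Nat.not_even_iff_odd.2 hodd)]
    rfl

theorem gateColor_add_of_adj (hs : 4 ≤ s) {x y : (gate s).V} (h : (gate s).adj x y) :
    gateColor s x + gateColor s y = 1 := by
  obtain ⟨a, rfl⟩ | ⟨j, hj, rfl⟩ := top_or_row x <;>
    obtain ⟨b, rfl⟩ | ⟨k, hk, rfl⟩ := top_or_row y
  · exact (by decide : ∀ a b : Fin 10, b ∈ topNeighbors a →
      (![1, 1, 0, 1, 0, 0, 1, 0, 1, 0] a + ![1, 1, 0, 1, 0, 0, 1, 0, 1, 0] b : ℤ) = 1)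
      a b (gate_adj_top_top.1 h)
  · exact gateColor_top_add_row hs hk h
  · rw [add_comm]
    exact gateColor_top_add_row hs hj (gate_adj_symm _ _ h)
  · rw [gateColor_row hj, gateColor_row hk]
    obtain rfl | rfl := (gate_adj_row_row hj hk).1 h <;> grind

theorem sum_gateColor (hs : 4 ≤ s) : ∑ x, (2 * gateColor s x - 1) = 1 := by
  have hsum : ∑ x, (2 * gateColor s x - 1) = ∑ a, (2 * gateColor s (top a) - 1) +
      ∑ j : Fin (2 * s - 7), (2 * gateColor s (row s j) - 1) := by
    simp only [row_of_lt (Fin.is_lt _)]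
    exact Fintype.sum_sum_type fun x : Fin 10 ⊕ Fin (2 * s - 7) => 2 * gateColor s x - 1
  have htop : ∑ a, (2 * gateColor s (top a) - 1) = 0 :=
    (by decide : ∑ a : Fin 10, (2 * (![1, 1, 0, 1, 0, 0, 1, 0, 1, 0] a : ℤ) - 1) = 0)
  have hrow (j : Fin (2 * s - 7)) : 2 * gateColor s (row s j) - 1 = (-1) ^ j.val := by
    rw [gateColor_row j.is_lt]
    split_ifs with hj
    · rw [hj.neg_one_pow]
      rfl
    · rw [(Nat.not_even_iff_odd.1 hj).neg_one_pow, mul_zero, zero_sub]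
  have hodd : ¬ Even (2 * s - 7) := Nat.not_even_iff_odd.2 ⟨s - 4, by omega⟩
  rw [hsum, htop, zero_add, Finset.sum_congr rfl fun j _ => hrow j,
    Fin.sum_univ_eq_sum_range (fun j => (-1 : ℤ) ^ j), neg_one_geom_sum, if_neg hodd]

theorem gateColor_of_mem_gateExternal {x : (gate s).V} (hx : x ∈ gateExternal s) :
    gateColor s x = 1 := by
  obtain rfl | rfl | rfl | ⟨i, hi, he, rfl⟩ := mem_gateExternal_cases hx
  exacts [rfl, rfl, rfl, (gateColor_row hi).trans (if_pos he)]

theorem degree_gate_zero_le (hs : 4 ≤ s) : (gate s).degree (top 0) ≤ s - 2 := by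
  have h : ∀ u, (gate s).adj (top 0) u →
      u ∈ [2, 7].map top ++ (List.range (s - 4)).map fun i => row s (2 * i + 1) := by
    intro u hu
    obtain ⟨a, rfl⟩ | ⟨j, hj, rfl⟩ := top_or_row u
    · exact List.mem_append_left _ (List.mem_map_of_mem (gate_adj_top_top.1 hu))
    · obtain ⟨h, -⟩ | ⟨h, -⟩ | ⟨-, i, rfl⟩ := (gate_adj_top_row hj).1 hu
      · exact absurd h (by decide)
      · exact absurd h (by decide)
      · exact List.mem_append_right _ (List.mem_map.2 ⟨i, List.mem_range.2 (by omega), rfl⟩)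
  refine (gate_noArc.degree_le_length h).trans ?_
  simp only [List.length_append, List.length_map, List.length_range, List.length_cons,
    List.length_nil]
  omega

open Classical in
theorem degree_gate_top_add_le {a : Fin 10} (ha : a ≠ 0) :
    (gate s).degree (top a) + (if top a ∈ gateExternal s then 1 else 0) ≤ 3 := by
  let ends (a : Fin 10) : List ℕ := if a = 4 then [0] else if a = 9 then [2 * s - 7 - 1] else []
  have h : ∀ u, (gate s).adj (top a) u → u ∈ (topNeighbors a).map top ++ (ends a).map (row s) := by
    intro u hu
    obtain ⟨b, rfl⟩ | ⟨j, hj, rfl⟩ := top_or_row u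
    · exact List.mem_append_left _ (List.mem_map_of_mem (gate_adj_top_top.1 hu))
    · refine List.mem_append_right _ (List.mem_map_of_mem ?_)
      obtain ⟨rfl, rfl⟩ | ⟨rfl, h⟩ | ⟨rfl, -⟩ := (gate_adj_top_row hj).1 hu
      · exact List.mem_singleton_self 0
      · exact List.mem_singleton.2 (Nat.eq_sub_of_add_eq h)
      · exact absurd rfl ha
  refine (Nat.add_le_add_right (gate_noArc.degree_le_length h) _).trans ?_
  simp only [List.length_append, List.length_map, top_mem_gateExternal, ends]
  fin_cases a <;> simp [topNeighbors] at ha ⊢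

open Classical in
theorem degree_gate_row_add_le {j : ℕ} (hj : j < 2 * s - 7) :
    (gate s).degree (row s j) + (if row s j ∈ gateExternal s then 1 else 0) ≤ 3 := by
  let left : (gate s).V := if j = 0 then top 4 else row s (j - 1)
  let right : (gate s).V := if j + 1 = 2 * s - 7 then top 9 else row s (j + 1)
  have h : ∀ u, (gate s).adj (row s j) u →
      u ∈ [left, right] ++ if Even j then [] else [top 0] := by
    intro u hu
    obtain ⟨b, rfl⟩ | ⟨k, hk, rfl⟩ := top_or_row u
    · obtain ⟨rfl, h⟩ | ⟨rfl, h⟩ | ⟨rfl, h⟩ := (gate_adj_top_row hj).1 (gate_adj_symm _ _ hu)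
      · simp [left, h]
      · simp [right, h]
      · simp [Nat.not_even_iff_odd.2 h]
    · obtain rfl | rfl := (gate_adj_row_row hj hk).1 hu
      · simp [right, hk.ne]
      · simp [left]
  refine (Nat.add_le_add_right (gate_noArc.degree_le_length h) _).trans ?_
  rw [row_mem_gateExternal hj]
  split_ifs <;> simp

theorem total_gate_le (f : (gate s).V → ℕ) {a c : ℕ} (h0 : f (top 0) ≤ a)
    (h : ∀ x, x ≠ top 0 → f x ≤ c) :
    (gate s).total f ≤ a + (9 + (2 * s - 7)) * c := by
  have htop : ∑ i : Fin 9, f (top i.succ) ≤ 9 * c := by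
    simpa using Finset.sum_le_card_nsmul Finset.univ (fun i : Fin 9 => f (top i.succ)) c
      fun i _ => h _ fun h => Fin.succ_ne_zero i (top_injective h)
  have hrow : ∑ j : Fin (2 * s - 7), f (row s j) ≤ (2 * s - 7) * c := by
    simpa using Finset.sum_le_card_nsmul Finset.univ (fun j : Fin (2 * s - 7) => f (row s j)) c
      fun j _ => h _ (by rw [row_of_lt j.is_lt]; exact Sum.inr_ne_inl)
  rw [total_gate, Fin.sum_univ_succ, add_mul]
  omega

section GateDegree

variable {M : MixedGraph} {v : M.V} {p : Kind × M.V → (gate s).V}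

theorem degree_inner_top_zero_le (hs : 4 ≤ s) (hp : Set.BijOn p (M.incident v) (gateExternal s)) :
    (M.replace v (gate s) p).degree (inner (top 0)) ≤ s - 1 := by
  classical
  rw [degree_inner_of_bijOn hp]
  have := degree_gate_zero_le hs
  split_ifs <;> omega

theorem degree_inner_gate_le (hp : Set.BijOn p (M.incident v) (gateExternal s))
    {x : (gate s).V} (hx : x ≠ top 0) : (M.replace v (gate s) p).degree (inner x) ≤ 3 := by
  classical
  rw [degree_inner_of_bijOn hp]
  obtain ⟨a, rfl⟩ | ⟨j, hj, rfl⟩ := top_or_row x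
  exacts [degree_gate_top_add_le fun h => hx (h ▸ rfl), degree_gate_row_add_le hj]

end GateDegree

/-- The number of vertices into which gates convert a vertex of degree `s`: of the vertices of an
`s`-gate, all but `top 0`, which has degree at most `s - 1`, have degree at most `3`. -/
def gateSize (s : ℕ) : ℕ := 1 + (s - 3) * (s + 6)

theorem gateSize_mono {a b : ℕ} (h : a ≤ b) : gateSize a ≤ gateSize b :=
  Nat.add_le_add_left (Nat.mul_le_mul (by omega) (by omega)) 1

theorem gateSize_of_le {a : ℕ} (h : a ≤ 3) : gateSize a = 1 := by
  simp [gateSize, Nat.sub_eq_zero_of_le h]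

theorem gateSize_sub_one (hs : 4 ≤ s) : gateSize (s - 1) + (9 + (2 * s - 7)) = gateSize s := by
  obtain ⟨n, rfl⟩ := Nat.exists_eq_add_of_le' hs
  have hn : 2 * (n + 4) - 7 = 2 * n + 1 := by omega
  simp only [gateSize, hn, Nat.reduceSubDiff, Nat.add_sub_cancel]
  ring

theorem GateStep.total_gateSize_le {M M' : MixedGraph} (h : GateStep M M') :
    M'.total (fun v => gateSize (M'.degree v)) ≤ M.total fun v => gateSize (M.degree v) := by
  obtain ⟨v, p, hs, hp, rfl⟩ := h
  have hreplace := total_replace (M := M) (v := v) (H := gate (M.degree v)) (p := p)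
    (f := fun x => gateSize (degree _ x)) (g := fun x => gateSize (M.degree x))
    fun w => by rw [degree_outer]
  have hgate := total_gate_le
    (fun x => gateSize ((M.replace v (gate (M.degree v)) p).degree (inner x)))
    (gateSize_mono (degree_inner_top_zero_le hs hp))
    fun x hx => (gateSize_of_le (degree_inner_gate_le hp hx)).le
  have := gateSize_sub_one hs
  omega

theorem gateStep_terminates : LoopTerminates GateStep := by
  refine .of_measure (fun M => M.total fun v => M.degree v - 3) ?_
  rintro M _ ⟨v, p, hs, hp, rfl⟩
  have hreplace := total_replace (M := M) (v := v) (H := gate (M.degree v)) (p := p)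
    (f := fun x => degree _ x - 3) (g := fun x => M.degree x - 3) fun w => by rw [degree_outer]
  have hgate := total_gate_le
    (fun x => (M.replace v (gate (M.degree v)) p).degree (inner x) - 3) (c := 0)
    (Nat.sub_le_sub_right (degree_inner_top_zero_le hs hp) 3)
    fun x hx => Nat.sub_le_of_le_add (degree_inner_gate_le hp hx)
  omega

theorem three_le_card_of_four_le_degree {M : MixedGraph} {v : M.V} (hv : 4 ≤ M.degree v) :
    3 ≤ Nat.card M.V := by
  have hkdeg (k : Kind) : M.kdeg k v + 1 ≤ Nat.card M.V := by
    have hsub : {u | (k, u) ∈ M.incident v} ⊆ {v}ᶜ := fun u hu huv =>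
      not_mem_incident_self (Set.mem_singleton_iff.1 huv ▸ hu)
    have hcard := Set.ncard_add_ncard_compl {v}
    rw [Set.ncard_singleton] at hcard
    have := Set.ncard_le_ncard hsub
    rw [kdeg]
    omega
  rw [degree_eq_kdeg_add_kdeg_add_kdeg] at hv
  have := hkdeg .inc
  have := hkdeg .out
  have := hkdeg .und
  omega

theorem GateStep.ham_iff {M M' : MixedGraph} (h : GateStep M M') : M'.Ham ↔ M.Ham := by
  obtain ⟨v, p, hs, hp, rfl⟩ := h
  have hcolor (x) (hx : x ∈ M.incident v) : gateColor _ (p x) = 1 :=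
    gateColor_of_mem_gateExternal (hp.mapsTo hx)
  constructor
  · refine Ham.of_replace_of_weight (exists_ne_of_degree_pos (by omega))
      (fun x => 2 * gateColor _ x - 1) (fun x => gateColor _ x - 1) (sum_gateColor hs)
      (fun x hx _ => ?_) (fun x hx _ => ?_) fun a b hab => ?_
    · rw [hcolor x hx, sub_self]
    · rw [hcolor x hx]
      rfl
    · linear_combination -gateColor_add_of_adj hs hab
  · refine Ham.replace (fun x hx y hy hxy _ _ => ?_)
      (.inr (three_le_card_of_four_le_degree hs))
    exact hasTraversal_gate hs (hp.mapsTo hx) (hp.mapsTo hy) (hp.injOn.ne hx hy hxy)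

theorem FourGateStep.gateStep {M M' : MixedGraph} (h : FourGateStep M M') : GateStep M M' := by
  obtain ⟨v, p, hv, hp, rfl⟩ := h
  generalize hs : 4 = s at p hv hp
  subst hv
  exact ⟨v, p, hs.le, hp, rfl⟩

theorem fourGateStep_terminates : LoopTerminates FourGateStep :=
  Subrelation.wf (fun {_ _} h => h.gateStep) gateStep_terminates

theorem gateExternal_eq_union :
    gateExternal s = top '' {0, 1, 8} ∪ (fun k => row s (2 * k)) '' Set.Iio (s - 3) := by
  ext x
  constructor
  · intro hx
    obtain rfl | rfl | rfl | ⟨i, hi, ⟨k, rfl⟩, rfl⟩ := mem_gateExternal_cases hx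
    · exact .inl ⟨0, by simp, rfl⟩
    · exact .inl ⟨1, by simp, rfl⟩
    · exact .inl ⟨8, by simp, rfl⟩
    · exact .inr ⟨k, Set.mem_Iio.2 (by omega), congrArg _ (two_mul k)⟩
  · rintro (⟨a, ha, rfl⟩ | ⟨k, hk, rfl⟩)
    · exact top_mem_gateExternal.2 ha
    · rw [Set.mem_Iio] at hk
      exact (row_mem_gateExternal (by omega)).2 (even_two_mul k)

theorem ncard_gateExternal (hs : 4 ≤ s) : (gateExternal s).ncard = s := by
  have hrow {k} (hk : k ∈ Set.Iio (s - 3)) : 2 * k < 2 * s - 7 := by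
    rw [Set.mem_Iio] at hk
    omega
  have hinj : Set.InjOn (fun k => row s (2 * k)) (Set.Iio (s - 3)) := by
    intro j hj k hk h
    simp only [row_of_lt (hrow hj), row_of_lt (hrow hk)] at h
    exact Nat.eq_of_mul_eq_mul_left two_pos (Fin.mk.inj (Sum.inr_injective h))
  have hdisj : Disjoint (top '' {0, 1, 8} : Set (gate s).V)
      ((fun k => row s (2 * k)) '' Set.Iio (s - 3)) := by
    rw [Set.disjoint_left]
    rintro _ ⟨a, -, rfl⟩ ⟨k, hk, h⟩
    simp only [row_of_lt (hrow hk)] at h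
    exact Sum.inr_ne_inl h
  have hthree : ({0, 1, 8} : Set (Fin 10)).ncard = 3 := by
    rw [Set.ncard_eq_toFinset_card']
    rfl
  rw [gateExternal_eq_union, Set.ncard_union_eq hdisj (Set.toFinite _) ((Set.finite_Iio _).image _),
    Set.ncard_image_of_injective _ top_injective, hinj.ncard_image, hthree,
    Set.ncard_eq_toFinset_card', Set.toFinset_Iio, Nat.card_Iio]
  omega

theorem exists_bijOn_of_ncard_eq {α β : Type*} [Finite α] [Finite β] [Nonempty β] {S : Set α}
    {T : Set β} (h : S.ncard = T.ncard) : ∃ f : α → β, Set.BijOn f S T := by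
  refine S.toFinite.exists_bijOn_of_encard_eq ?_
  rw [← S.toFinite.cast_ncard_eq, ← T.toFinite.cast_ncard_eq, h]

theorem degree_le_of_forall_not_gateStep {M : MixedGraph} (h : ∀ M', ¬ GateStep M M') (v : M.V) :
    M.degree v ≤ 3 := by
  by_contra! hv
  have : Nonempty (gate (M.degree v)).V := ⟨top 0⟩
  obtain ⟨p, hp⟩ := exists_bijOn_of_ncard_eq (S := M.incident v)
    (T := gateExternal (M.degree v)) (ncard_gateExternal hv).symm
  exact h _ ⟨v, p, hv, hp, rfl⟩

theorem degree_ne_of_forall_not_fourGateStep {M : MixedGraph} (h : ∀ M', ¬ FourGateStep M M')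
    (v : M.V) : M.degree v ≠ 4 := by
  intro hv
  have : Nonempty (gate 4).V := ⟨top 0⟩
  obtain ⟨p, hp⟩ := exists_bijOn_of_ncard_eq (S := M.incident v)
    (T := gateExternal 4) (hv.trans (ncard_gateExternal le_rfl).symm)
  exact h _ ⟨v, p, hv, hp, rfl⟩

theorem GateStep.reduction {M M' : MixedGraph} (h : GateStep M M') {c : ℕ} (hc : c ≤ 3) :
    Reduction c M M' where
  ham_iff := h.ham_iff
  exists_degree_le := by
    obtain ⟨v, p, hs, -, rfl⟩ := h
    exact exists_degree_le_replace (hc.trans_lt hs)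

theorem reduction_of_gateSteps {M B : MixedGraph} (h : ReflTransGen GateStep M B) {c : ℕ}
    (hc : c ≤ 3) : Reduction c M B :=
  invariant_of_reflTransGen h (.refl c M) fun _ _ hstep hred => hred.trans (hstep.reduction hc)

theorem card_le_of_gateSteps {M B : MixedGraph} (h : ReflTransGen GateStep M B) :
    Nat.card B.V ≤ M.total fun v => gateSize (M.degree v) :=
  calc Nat.card B.V
      = B.total fun _ => 1 := by rw [total_const, mul_one]
    _ ≤ B.total fun v => gateSize (B.degree v) := total_mono fun v => Nat.le_add_right _ _
    _ ≤ M.total fun v => gateSize (M.degree v) :=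
      invariant_of_reflTransGen (P := fun X =>
        X.total (fun v => gateSize (X.degree v)) ≤ M.total fun v => gateSize (M.degree v)) h
        le_rfl fun _ _ hstep hle => hstep.total_gateSize_le.trans hle

theorem FourGateStep.noArc {M M' : MixedGraph} (h : FourGateStep M M') (hM : M.NoArc) :
    M'.NoArc := by
  obtain ⟨v, p, -, -, rfl⟩ := h
  exact hM.replace gate_noArc

theorem FourGateStep.degree_le_four {M M' : MixedGraph} (h : FourGateStep M M')
    (hM : ∀ v, M.degree v ≤ 4) (x : M'.V) : M'.degree x ≤ 4 := by
  obtain ⟨v, p, -, hp, rfl⟩ := h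
  obtain ⟨w, rfl⟩ | ⟨x, rfl⟩ := outer_or_inner x
  · exact (degree_outer w).trans_le (hM w)
  · obtain rfl | hx := eq_or_ne x (top 0)
    · exact (degree_inner_top_zero_le le_rfl hp).trans (by decide)
    · exact (degree_inner_gate_le hp hx).trans (by decide)

theorem degree_le_three_of_runLoop_fourGateStep {M D : MixedGraph} (hM : ∀ v, M.degree v ≤ 4)
    (h : RunLoop FourGateStep M D) (v : D.V) : D.degree v ≤ 3 := by
  have := invariant_of_reflTransGen h.1 hM (fun _ _ hstep => hstep.degree_le_four) v
  have := degree_ne_of_forall_not_fourGateStep h.2 v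
  omega

end Gate

/-! ### Karp's conversion -/

section Karp

variable {B : MixedGraph} {i j : B.V} {a b : Fin 3}

theorem karp_noArc (B : MixedGraph) : (karp B).NoArc := fun _ _ => id

/-- The vertex `(i, a)` of Karp's conversion: the vertex of index `a` on the path into which `i` is
converted. -/
def karpVertex (i : B.V) (a : Fin 3) : (karp B).V := ((i, a) : B.V × Fin 3)

theorem karpVertex_inj : karpVertex i a = karpVertex j b ↔ i = j ∧ a = b := Prod.mk_inj

theorem exists_eq_karpVertex (x : (karp B).V) : ∃ i a, x = karpVertex i a := ⟨x.1, x.2, rfl⟩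

theorem card_karp (B : MixedGraph) : Nat.card (karp B).V = 3 * Nat.card B.V := by
  have h : Nat.card (karp B).V = Nat.card (B.V × Fin 3) := rfl
  rw [h, Nat.card_prod, Nat.card_eq_fintype_card (α := Fin 3), Fintype.card_fin, mul_comm]

theorem karp_adj_iff :
    (karp B).adj (karpVertex i a) (karpVertex j b) ↔
      (i = j ∧ ((a = 1 ∧ b ≠ 1) ∨ (b = 1 ∧ a ≠ 1))) ∨ (B.adj i j ∧ a = 2 ∧ b = 0) ∨
        (B.adj j i ∧ b = 2 ∧ a = 0) := by
  have h : (karp B).adj (karpVertex i a) (karpVertex j b) ↔ karpVertex i a ≠ karpVertex j b ∧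
      (((i = j ∧ a = 1 ∧ (b = 0 ∨ b = 2)) ∨ (B.adj i j ∧ a = 2 ∧ b = 0)) ∨
        ((j = i ∧ b = 1 ∧ (a = 0 ∨ a = 2)) ∨ (B.adj j i ∧ b = 2 ∧ a = 0))) :=
    (karp_noArc B).adj_iff
  rw [h, Ne, karpVertex_inj]
  grind

theorem karpVertex_one_adj (h : (karp B).adj (karpVertex i 1) (karpVertex j b)) :
    j = i ∧ (b = 0 ∨ b = 2) := by
  rw [karp_adj_iff] at h
  grind

theorem karpVertex_two_adj (h : (karp B).adj (karpVertex i 2) (karpVertex j b)) :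
    (j = i ∧ b = 1) ∨ (B.adj i j ∧ b = 0) := by
  rw [karp_adj_iff] at h
  grind

theorem karpVertex_zero_adj (h : (karp B).adj (karpVertex i 0) (karpVertex j b)) :
    (j = i ∧ b = 1) ∨ (B.adj j i ∧ b = 2) := by
  rw [karp_adj_iff] at h
  grind

theorem ncard_adj_left_le (i : B.V) : {j | B.adj j i}.ncard ≤ B.degree i := by
  have hsub : {j | B.adj j i} ⊆ Prod.snd '' B.incident i := fun j hj => by
    obtain ⟨x, hx, -, rfl⟩ := adj_iff_exists_incident_left.1 hj
    exact ⟨x, hx, rfl⟩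
  exact (Set.ncard_le_ncard hsub).trans (Set.ncard_image_le (Set.toFinite _))

theorem ncard_adj_right_le (i : B.V) : {j | B.adj i j}.ncard ≤ B.degree i := by
  have hsub : {j | B.adj i j} ⊆ Prod.snd '' B.incident i := fun j hj => by
    obtain ⟨x, hx, -, rfl⟩ := adj_iff_exists_incident_right.1 hj
    exact ⟨x, hx, rfl⟩
  exact (Set.ncard_le_ncard hsub).trans (Set.ncard_image_le (Set.toFinite _))

theorem degree_karp_le_ncard_add_one {S : Set B.V} {x : (karp B).V}
    (h : ∀ j b, (karp B).adj x (karpVertex j b) → (j = i ∧ b = 1) ∨ (j ∈ S ∧ b = a)) :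
    (karp B).degree x ≤ S.ncard + 1 := by
  have hsub : (karp B).edge.neighborSet x ⊆
      insert (karpVertex i 1) ((karpVertex · a) '' S) := fun y hy => by
    obtain ⟨j, b, rfl⟩ := exists_eq_karpVertex y
    obtain ⟨rfl, rfl⟩ | ⟨hj, rfl⟩ := h j b (.inr hy)
    exacts [.inl rfl, .inr ⟨j, hj, rfl⟩]
  rw [(karp_noArc B).degree_eq]
  exact (Set.ncard_le_ncard hsub).trans <| (Set.ncard_insert_le _ _).trans <|
    Nat.add_le_add_right (Set.ncard_image_le (Set.toFinite _)) 1

theorem degree_karpVertex_zero_le (i : B.V) :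
    (karp B).degree (karpVertex i 0) ≤ B.degree i + 1 :=
  (degree_karp_le_ncard_add_one fun _ _ => karpVertex_zero_adj).trans
    (Nat.add_le_add_right (ncard_adj_left_le i) 1)

theorem degree_karpVertex_two_le (i : B.V) :
    (karp B).degree (karpVertex i 2) ≤ B.degree i + 1 :=
  (degree_karp_le_ncard_add_one fun _ _ => karpVertex_two_adj).trans
    (Nat.add_le_add_right (ncard_adj_right_le i) 1)

theorem degree_karpVertex_one_le (i : B.V) : (karp B).degree (karpVertex i 1) ≤ 2 := by
  refine (karp_noArc B).degree_le_length (l := [karpVertex i 0, karpVertex i 2]) fun x hx => ?_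
  obtain ⟨j, a, rfl⟩ := exists_eq_karpVertex x
  obtain ⟨rfl, rfl | rfl⟩ := karpVertex_one_adj hx <;> simp

theorem degree_karp_le {n : ℕ} (hn : 1 ≤ n) (hB : ∀ i, B.degree i ≤ n) (x : (karp B).V) :
    (karp B).degree x ≤ n + 1 := by
  obtain ⟨i, a, rfl⟩ := exists_eq_karpVertex x
  fin_cases a
  exacts [(degree_karpVertex_zero_le i).trans (Nat.add_le_add_right (hB i) 1),
    (degree_karpVertex_one_le i).trans (Nat.add_le_add_right hn 1),
    (degree_karpVertex_two_le i).trans (Nat.add_le_add_right (hB i) 1)]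

theorem karp_ham (h : B.Ham) : (karp B).Ham := by
  obtain ⟨⟨i⟩, f, hf, hadj⟩ := h
  let f' : (karp B).V → (karp B).V := fun x =>
    ![karpVertex x.1 1, karpVertex x.1 2, karpVertex (f x.1) 0] x.2
  have h01 (i : B.V) : ReflTransGen (f' · = ·) (karpVertex i 0) (karpVertex i 1) := .single rfl
  have h12 (i : B.V) : ReflTransGen (f' · = ·) (karpVertex i 1) (karpVertex i 2) := .single rfl
  have h20 (i : B.V) : ReflTransGen (f' · = ·) (karpVertex i 2) (karpVertex (f i) 0) := .single rfl
  refine ⟨⟨karpVertex i 0⟩, f', hf.expand (ι := (karpVertex · 0)) ?_ ?_ ?_, ?_⟩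
  · exact fun i => ((h01 i).trans (h12 i)).trans (h20 i)
  · rintro ⟨i, a⟩
    fin_cases a
    exacts [⟨i, .refl⟩, ⟨f i, (h12 i).trans (h20 i)⟩, ⟨f i, h20 i⟩]
  · rintro ⟨i, a⟩
    fin_cases a
    exacts [⟨i, .refl⟩, ⟨i, h01 i⟩, ⟨i, (h01 i).trans (h12 i)⟩]
  · rintro ⟨i, a⟩
    fin_cases a
    exacts [karp_adj_iff.2 (by simp), karp_adj_iff.2 (by simp),
      karp_adj_iff.2 (.inr (.inl ⟨hadj i, rfl, rfl⟩))]

/-- The map `f` runs through the path that corresponds to the vertex `i` in its order. -/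
def Forward (f : (karp B).V → (karp B).V) (i : B.V) : Prop :=
  f (karpVertex i 0) = karpVertex i 1 ∧ f (karpVertex i 1) = karpVertex i 2

section Backward

variable {f : (karp B).V → (karp B).V}

theorem forward_or_backward (hf : IsSingleCycle f) (hadj : ∀ x, (karp B).adj x (f x)) (i : B.V) :
    Forward f i ∨ (f (karpVertex i 2) = karpVertex i 1 ∧ f (karpVertex i 1) = karpVertex i 0) := by
  have hno_return (x : (karp B).V) : f (f x) ≠ x := fun hx => by
    have hcard := hf.card_le_two hx
    have : Nonempty B.V := ⟨i⟩
    have := Nat.card_pos (α := B.V)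
    rw [card_karp] at hcard
    omega
  obtain ⟨j, a, hnext⟩ := exists_eq_karpVertex (f (karpVertex i 1))
  obtain ⟨y, hy⟩ := hf.surjective (karpVertex i 1)
  obtain ⟨k, b, rfl⟩ := exists_eq_karpVertex y
  obtain ⟨rfl, ha⟩ := karpVertex_one_adj (hnext ▸ hadj (karpVertex i 1))
  obtain ⟨rfl, hb⟩ := karpVertex_one_adj ((karp_noArc B).adj_symm _ _ (hy ▸ hadj (karpVertex k b)))
  have hab : a ≠ b := by
    rintro rfl
    exact hno_return _ (hy.symm ▸ hnext)
  obtain rfl | rfl := ha <;> obtain rfl | rfl := hb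
  exacts [absurd rfl hab, .inr ⟨hy, hnext⟩, .inl ⟨hy, hnext⟩, absurd rfl hab]

theorem Forward.exists_next (hf : IsSingleCycle f) (hadj : ∀ x, (karp B).adj x (f x))
    (hi : Forward f i) : ∃ j, f (karpVertex i 2) = karpVertex j 0 ∧ B.adj i j ∧ Forward f j := by
  have hinj (a b : Fin 3) (j k : B.V) (h : f (karpVertex j a) = f (karpVertex k b)) : a = b :=
    (karpVertex_inj.1 (hf.bijective.injective h)).2
  obtain ⟨j, a, hnext⟩ := exists_eq_karpVertex (f (karpVertex i 2))
  obtain ⟨rfl, rfl⟩ | ⟨hij, rfl⟩ := karpVertex_two_adj (hnext ▸ hadj (karpVertex i 2))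
  · exact absurd (hinj 2 0 _ _ (hnext.trans hi.1.symm)) (by decide)
  · refine ⟨j, hnext, hij, (forward_or_backward hf hadj j).resolve_right fun hj => ?_⟩
    exact absurd (hinj 2 1 _ _ (hnext.trans hj.2.symm)) (by decide)

theorem ham_of_forward (hf : IsSingleCycle f) (hadj : ∀ x, (karp B).adj x (f x))
    (hi : Forward f i) : B.Ham := by
  let π : (karp B).V → B.V := Prod.fst
  have hmaps : Set.MapsTo f {x | Forward f (π x)} {x | Forward f (π x)} := fun x hx => by
    obtain ⟨j, a, rfl⟩ := exists_eq_karpVertex x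
    change Forward f j at hx
    fin_cases a
    · exact Set.mem_of_eq_of_mem hx.1 hx
    · exact Set.mem_of_eq_of_mem hx.2 hx
    · obtain ⟨k, hk, -, hforward⟩ := hx.exists_next hf hadj
      exact Set.mem_of_eq_of_mem hk hforward
  have hforward (j : B.V) : Forward f j :=
    hf.mem_of_mapsTo hmaps (a := karpVertex i 0) hi (karpVertex j 0)
  refine ⟨⟨i⟩, fun j => π (f (karpVertex j 2)),
    hf.contract (π := π) (fun j => ⟨karpVertex j 0, rfl⟩) fun x => ?_, fun j => ?_⟩
  · obtain ⟨j, a, rfl⟩ := exists_eq_karpVertex x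
    fin_cases a
    exacts [.inl (congrArg π (hforward j).1 :), .inl (congrArg π (hforward j).2 :), .inr rfl]
  · obtain ⟨k, hk, hjk, -⟩ := (hforward j).exists_next hf hadj
    exact Set.mem_of_eq_of_mem (s := {x | B.adj j x}) (congrArg π hk) hjk

end Backward

theorem karp_ham_iff (B : MixedGraph) : (karp B).Ham ↔ B.Ham := by
  refine ⟨fun ⟨⟨x⟩, f, hf, hadj⟩ => ?_, karp_ham⟩
  rcases forward_or_backward hf hadj x.1 with hforward | ⟨h21, h10⟩
  · exact ham_of_forward hf hadj hforward
  · let σ := Equiv.ofBijective f hf.bijective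
    have hadj' (y : (karp B).V) : (karp B).adj y (σ.symm y) := by
      have := hadj (σ.symm y)
      rw [show f (σ.symm y) = y from σ.apply_symm_apply y] at this
      exact (karp_noArc B).adj_symm _ _ this
    exact ham_of_forward (hf.of_rightInverse σ.left_inv) hadj' (i := x.1)
      ⟨σ.symm_apply_eq.2 h10.symm, σ.symm_apply_eq.2 h21.symm⟩

end Karp

end HCP

namespace MixedGraph

theorem NoArc.degree_eq_card {M : MixedGraph} [Fintype M.V] [DecidableRel M.adj] (hM : M.NoArc)
    (v : M.V) : M.degree v = (Finset.univ.filter fun u => M.adj v u).card := by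
  have h : M.edge.neighborSet v = {u | M.adj v u} := Set.ext fun _ => hM.adj_iff.symm
  rw [hM.degree_eq, h, Set.ncard_eq_toFinset_card', Set.toFinset_ofPred]

end MixedGraph

namespace HCP

open MixedGraph

/-! ### The Petersen graph -/

/-- The relation is the adjacency relation of an undirected loopless graph of minimum degree at
least `3` and girth at least `5`. -/
structure MinDegreeThreeGirthFive {V : Type*} (R : V → V → Prop) : Prop where
  symm : ∀ x y, R x y → R y x
  exists_third : ∀ x y z, ∃ w, R x w ∧ w ≠ y ∧ w ≠ z
  not_triangle : ∀ x y z, R x y → R y z → ¬ R z x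
  eq_or_eq : ∀ x y z w, R x y → R y z → R z w → R w x → x = z ∨ y = w

namespace MinDegreeThreeGirthFive

theorem comp_equiv {V W : Type*} {R : V → V → Prop} (hR : MinDegreeThreeGirthFive R)
    (e : W ≃ V) : MinDegreeThreeGirthFive fun i j => R (e i) (e j) where
  symm _ _ := hR.symm _ _
  exists_third i j k := by
    obtain ⟨w, hw⟩ := hR.exists_third (e i) (e j) (e k)
    exact ⟨e.symm w, by simpa [e.symm_apply_eq] using hw⟩
  not_triangle _ _ _ := hR.not_triangle _ _ _
  eq_or_eq _ _ _ _ hij hjk hkl hli :=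
    (hR.eq_or_eq _ _ _ _ hij hjk hkl hli).imp (e.injective ·) (e.injective ·)

section TenCycle

variable {R : ZMod 10 → ZMod 10 → Prop}

theorem exists_long_chord (hR : MinDegreeThreeGirthFive R) (hsucc : ∀ i j, j = i + 1 → R i j)
    (i : ZMod 10) : ∃ j, R i j ∧ (j = i + 4 ∨ j = i + 5 ∨ j = i + 6) := by
  obtain ⟨j, hij, hj1, hj9⟩ := hR.exists_third i (i + 1) (i - 1)
  have hji := hR.symm _ _ hij
  have hj0 : j ≠ i := by
    rintro rfl
    exact hR.not_triangle _ _ _ hij hij hij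
  have hj2 : j ≠ i + 2 := fun h =>
    hR.not_triangle i (i + 1) j (hsucc _ _ rfl) (hsucc _ _ (by grind)) hji
  have hj8 : j ≠ i - 2 := fun h =>
    hR.not_triangle i j (i - 1) hij (hsucc _ _ (by grind)) (hsucc _ _ (by grind))
  have hj3 : j ≠ i + 3 := fun h => by
    have := hR.eq_or_eq i (i + 1) (i + 2) j (hsucc _ _ rfl) (hsucc _ _ (by grind))
      (hsucc _ _ (by grind)) hji
    grind
  have hj7 : j ≠ i - 3 := fun h => by
    have := hR.eq_or_eq i j (i - 2) (i - 1) hij (hsucc _ _ (by grind)) (hsucc _ _ (by grind))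
      (hsucc _ _ (by grind))
    grind
  have hcases : ∀ i j : ZMod 10, j = i ∨ j = i + 1 ∨ j = i + 2 ∨ j = i + 3 ∨ j = i - 3 ∨
      j = i - 2 ∨ j = i - 1 ∨ j = i + 4 ∨ j = i + 5 ∨ j = i + 6 := by
    decide
  exact ⟨j, hij, by simpa only [hj0, hj1, hj2, hj3, hj7, hj8, hj9, false_or] using hcases i j⟩

theorem not_add_four (hR : MinDegreeThreeGirthFive R) (hsucc : ∀ i j, j = i + 1 → R i j)
    (i : ZMod 10) : ¬ R i (i + 4) := by
  intro h
  have h45 : R (i + 4) (i + 5) := hsucc _ _ (by ring)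
  obtain ⟨j, hj, hij⟩ := hR.exists_long_chord hsucc (i + 5)
  obtain rfl | rfl | rfl : j = i - 1 ∨ j = i ∨ j = i + 1 := by grind
  · have := hR.eq_or_eq i (i + 4) (i + 5) (i - 1) h h45 hj (hsucc _ _ (by ring))
    grind
  · exact hR.not_triangle _ _ _ h h45 hj
  · have := hR.eq_or_eq i (i + 4) (i + 5) (i + 1) h h45 hj (hR.symm _ _ (hsucc _ _ rfl))
    grind

theorem add_five (hR : MinDegreeThreeGirthFive R) (hsucc : ∀ i j, j = i + 1 → R i j)
    (i : ZMod 10) : R i (i + 5) := by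
  obtain ⟨j, hij, rfl | rfl | rfl⟩ := hR.exists_long_chord hsucc i
  · exact absurd hij (hR.not_add_four hsucc i)
  · exact hij
  · have hi : i = i + 6 + 4 := by grind
    refine absurd (hR.symm _ _ hij) fun h => hR.not_add_four hsucc (i + 6) ?_
    rwa [← hi]

end TenCycle

theorem not_hasTour {V : Type*} {R : V → V → Prop} (hR : MinDegreeThreeGirthFive R)
    (hV : Nat.card V = 10) : ¬ HasTour R := by
  have : Finite V := Nat.finite_of_card_ne_zero (by omega)
  rw [hasTour_iff_exists_equiv_zmod, hV]
  rintro ⟨e, he⟩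
  have hsucc (i j) (h : j = i + 1) : R (e i) (e j) := h ▸ he i
  have hS := hR.comp_equiv e
  obtain h | h := hS.eq_or_eq 0 1 6 5 (hsucc _ _ rfl) (hS.add_five hsucc 1)
    (hS.symm _ _ (hsucc _ _ rfl)) (hS.symm _ _ (hS.add_five hsucc 0))
  · exact absurd h (by decide)
  · exact absurd h (by decide)

end MinDegreeThreeGirthFive

theorem petersen_noArc : petersen.NoArc := fun _ _ => id

instance : Fintype petersen.V := inferInstanceAs (Fintype (Fin 5 × Bool))

instance : DecidableEq petersen.V := inferInstanceAs (DecidableEq (Fin 5 × Bool))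

instance : DecidableRel petersen.adj := fun x y => inferInstanceAs <| Decidable <|
  let R (x y : Fin 5 × Bool) : Prop := (x.2 = false ∧ y.2 = false ∧ y.1 = x.1 + 1) ∨
    (x.2 = false ∧ y.2 = true ∧ y.1 = x.1) ∨ (x.2 = true ∧ y.2 = true ∧ y.1 = x.1 + 2)
  False ∨ (x : Fin 5 × Bool) ≠ y ∧ (R x y ∨ R y x)

theorem minDegreeThreeGirthFive_petersen : MinDegreeThreeGirthFive petersen.adj where
  symm := petersen_noArc.adj_symm
  exists_third := by decide +kernel
  not_triangle := by decide +kernel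
  eq_or_eq := by decide +kernel

theorem card_petersen : Nat.card petersen.V = 10 := by
  rw [Nat.card_eq_fintype_card]
  rfl

theorem petersen_not_ham : ¬ petersen.Ham :=
  minDegreeThreeGirthFive_petersen.not_hasTour card_petersen

theorem degree_petersen (x : petersen.V) : petersen.degree x = 3 := by
  rw [petersen_noArc.degree_eq_card]
  decide +revert

end HCP

namespace MixedGraph

variable {M : MixedGraph} {v : M.V}

theorem NoArc.degree_lt_card (hM : M.NoArc) (v : M.V) : M.degree v < Nat.card M.V := by
  rw [hM.degree_eq, ← Set.ncard_univ]
  exact Set.ncard_lt_ncard (Set.ssubset_univ_iff.2 fun h =>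
    M.edge.notMem_neighborSet_self (h ▸ Set.mem_univ v))

theorem not_ham_of_degree_le_one (hM : 3 ≤ Nat.card M.V) (hv : M.degree v ≤ 1) : ¬ M.Ham := by
  rintro ⟨-, f, hf, hfM⟩
  obtain ⟨u, rfl⟩ := hf.surjective v
  obtain ⟨x, hx, -, hxu⟩ := adj_iff_exists_incident_left.1 (hfM u)
  obtain ⟨y, hy, -, hyf⟩ := adj_iff_exists_incident_right.1 (hfM (f u))
  have hxy : x = y := (Set.ncard_le_one (Set.toFinite _)).1 hv x hx y hy
  have := hf.card_le_two (a := u) (by rw [← hyf, ← hxy, hxu])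
  omega

end MixedGraph

namespace HCP

open MixedGraph

/-! ### From sub-cubic to cubic graphs -/

theorem diamond_noArc : diamond.NoArc := fun _ _ => id

instance : Fintype diamond.V := inferInstanceAs (Fintype (Fin 4))

instance : DecidableEq diamond.V := inferInstanceAs (DecidableEq (Fin 4))

instance (i : ℕ) : OfNat diamond.V i := inferInstanceAs (OfNat (Fin 4) i)

instance : DecidableRel diamond.adj := fun (x y : Fin 4) => inferInstanceAs <| Decidable <|
  False ∨ (s(x, y) = s(0, 1) ∨ s(x, y) = s(0, 2) ∨ s(x, y) = s(1, 2) ∨ s(x, y) = s(1, 3) ∨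
    s(x, y) = s(2, 3)) ∧ x ≠ y

theorem card_diamond : Nat.card diamond.V = 4 := by
  rw [Nat.card_eq_fintype_card]
  rfl

theorem degree_diamond (x : diamond.V) : diamond.degree x = if x = 0 ∨ x = 3 then 2 else 3 := by
  rw [diamond_noArc.degree_eq_card]
  decide +revert

theorem hasTraversal_diamond {a b : diamond.V} (ha : a ∈ ({0, 3} : Set diamond.V))
    (hb : b ∈ ({0, 3} : Set diamond.V)) (hab : a ≠ b) : HasTraversal diamond.adj a b := by
  have h : HasTraversal diamond.adj 0 3 :=
    hasTraversal_of_isChain (l := [0, 1, 2, 3]) (by decide) (by decide) (by decide) rfl rfl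
  rcases ha with rfl | rfl <;> rcases hb with rfl | rfl
  · exact absurd rfl hab
  · exact h
  · exact h.symm diamond_noArc.adj_symm
  · exact absurd rfl hab

theorem degree_inner_diamond {M : MixedGraph} {v : M.V} {p : Kind × M.V → diamond.V}
    (hp : Set.BijOn p (M.incident v) {0, 3}) (x : diamond.V) :
    (M.replace v diamond p).degree (inner x) = 3 := by
  rw [degree_inner_of_bijOn hp, degree_diamond]
  split_ifs <;> first | rfl | contradiction

namespace DiamondStep

variable {M M' : MixedGraph}

theorem ham_iff (hM : M.NoArc) (h : DiamondStep M M') : M'.Ham ↔ M.Ham := by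
  obtain ⟨v, (p : _ → diamond.V), hv, hp, rfl⟩ := h
  have : Nonempty diamond.V := ⟨0⟩
  constructor
  · refine Ham.of_replace_of_degree_le_two (exists_ne_of_degree_pos (by omega)) hv.le ?_
    have := Nat.card_le_card_of_injective _ (inner_injective (M := M) (v := v) (p := p))
    rw [card_diamond] at this
    omega
  · refine Ham.replace (fun x hx y hy hxy _ _ =>
      hasTraversal_diamond (hp.mapsTo hx) (hp.mapsTo hy) (hp.injOn.ne hx hy hxy)) (.inr ?_)
    have := hM.degree_lt_card v
    omega

theorem noArc (hM : M.NoArc) (h : DiamondStep M M') : M'.NoArc := by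
  obtain ⟨v, p, -, -, rfl⟩ := h
  exact hM.replace diamond_noArc

theorem degree_eq_two_or_three (hM : ∀ v, M.degree v = 2 ∨ M.degree v = 3)
    (h : DiamondStep M M') (x : M'.V) : M'.degree x = 2 ∨ M'.degree x = 3 := by
  obtain ⟨v, (p : _ → diamond.V), -, hp, rfl⟩ := h
  obtain ⟨w, rfl⟩ | ⟨x, rfl⟩ := outer_or_inner x
  · rw [degree_outer]
    exact hM w
  · exact .inr (degree_inner_diamond hp x)

theorem total_degree (h : DiamondStep M M') (F : ℕ → ℕ) :
    M'.total (fun v => F (M'.degree v)) + F 2 = M.total (fun v => F (M.degree v)) + 4 * F 3 := by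
  obtain ⟨v, (p : _ → diamond.V), hv, hp, rfl⟩ := h
  have := total_replace (M := M) (v := v) (H := diamond) (p := p)
    (f := fun x => F (degree _ x)) (g := fun x => F (M.degree x)) fun w => by rw [degree_outer]
  simpa only [degree_inner_diamond hp, total_const, card_diamond, hv] using this

end DiamondStep

theorem diamondStep_terminates : LoopTerminates DiamondStep := by
  refine .of_measure (fun M => M.total fun v => if M.degree v = 2 then 1 else 0) fun M M' h => ?_
  have := h.total_degree fun n => if n = 2 then 1 else 0
  rw [if_pos rfl, if_neg (by decide)] at this
  omega

theorem degree_ne_of_forall_not_diamondStep {M : MixedGraph} (h : ∀ M', ¬ DiamondStep M M')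
    (v : M.V) : M.degree v ≠ 2 := by
  intro hv
  have h2 : (M.incident v).ncard = ({0, 3} : Set (Fin 4)).ncard :=
    hv.trans (Set.ncard_pair (by decide)).symm
  obtain ⟨p, hp⟩ := exists_bijOn_of_ncard_eq h2
  exact h _ ⟨v, p, hv, hp, rfl⟩

theorem ham_iff_of_diamondSteps {D H : MixedGraph} (hD : D.NoArc)
    (h : ReflTransGen DiamondStep D H) : H.NoArc ∧ (H.Ham ↔ D.Ham) :=
  invariant_of_reflTransGen (P := fun X => X.NoArc ∧ (X.Ham ↔ D.Ham)) h ⟨hD, .rfl⟩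
    fun _ _ hstep ⟨hX, hham⟩ => ⟨hstep.noArc hX, (hstep.ham_iff hX).trans hham⟩

theorem degree_eq_three_of_runLoop_diamondStep {D H : MixedGraph}
    (hD : ∀ v, D.degree v = 2 ∨ D.degree v = 3) (h : RunLoop DiamondStep D H) (v : H.V) :
    H.degree v = 3 :=
  (invariant_of_reflTransGen h.1 hD (fun _ _ hstep hX => hstep.degree_eq_two_or_three hX)
    v).resolve_left (degree_ne_of_forall_not_diamondStep h.2 v)

theorem card_le_of_diamondSteps {D H : MixedGraph} (h : ReflTransGen DiamondStep D H) :
    Nat.card H.V ≤ 4 * Nat.card D.V := by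
  let size (M : MixedGraph) : ℕ := M.total fun v => if M.degree v = 2 then 4 else 1
  have hsize : size H = size D := invariant_of_reflTransGen (P := fun X => size X = size D) h rfl
    fun X Y hstep hX => by
      have := hstep.total_degree fun n => if n = 2 then 4 else 1
      exact (Nat.add_right_cancel this).trans hX
  calc Nat.card H.V = H.total fun _ => 1 := by rw [total_const, mul_one]
    _ ≤ size H := total_mono fun v => by split_ifs <;> decide
    _ = size D := hsize
    _ ≤ D.total fun _ => 4 := total_mono fun v => by split_ifs <;> decide
    _ = 4 * Nat.card D.V := by rw [total_const, mul_comm]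

namespace SubcubicToCubic

variable {D H : MixedGraph}

theorem noArc (hD : D.NoArc) (h : SubcubicToCubic D H) : H.NoArc := by
  obtain ⟨-, rfl⟩ | ⟨-, h⟩ := h
  · exact petersen_noArc
  · exact (ham_iff_of_diamondSteps hD h.1).1

theorem degree_eq_three (hD : ∀ v, D.degree v ≤ 3) (h : SubcubicToCubic D H) (x : H.V) :
    H.degree x = 3 := by
  obtain ⟨-, rfl⟩ | ⟨hv, h⟩ := h
  · exact degree_petersen x
  · refine degree_eq_three_of_runLoop_diamondStep (fun v => ?_) h x
    have := hD v
    have : ¬ D.degree v ≤ 1 := fun h => hv ⟨v, h⟩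
    omega

theorem ham_iff (hD : D.NoArc) (hcard : Nat.card D.V = 0 ∨ 3 ≤ Nat.card D.V)
    (h : SubcubicToCubic D H) : H.Ham ↔ D.Ham := by
  obtain ⟨⟨v, hv⟩, rfl⟩ | ⟨-, h⟩ := h
  · have : Nonempty D.V := ⟨v⟩
    exact iff_of_false petersen_not_ham
      (not_ham_of_degree_le_one (hcard.resolve_left Nat.card_pos.ne') hv)
  · exact (ham_iff_of_diamondSteps hD h.1).2

theorem card_le (h : SubcubicToCubic D H) : Nat.card H.V ≤ 10 * Nat.card D.V := by
  obtain ⟨⟨v, -⟩, rfl⟩ | ⟨-, h⟩ := h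
  · have : Nonempty D.V := ⟨v⟩
    rw [card_petersen]
    exact Nat.le_mul_of_pos_right 10 Nat.card_pos
  · exact (card_le_of_diamondSteps h.1).trans (Nat.mul_le_mul_right _ (by decide))

theorem card_le_ten (hD : ∃ v, D.degree v ≤ 1) (h : SubcubicToCubic D H) : Nat.card H.V ≤ 10 := by
  obtain ⟨-, rfl⟩ | ⟨hv, -⟩ := h
  · exact card_petersen.le
  · exact absurd hD hv

end SubcubicToCubic

end HCP

namespace MixedGraph.NoArc

variable {H : MixedGraph}

theorem hasHamiltonianCycle_iff (hH : H.NoArc) (hcard : Nat.card H.V = 0 ∨ 3 ≤ Nat.card H.V) :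
    HCP.HasHamiltonianCycle H ↔ H.Ham := by
  let _ : DecidableEq H.V := Classical.decEq H.V
  let _ : Fintype H.V := Fintype.ofFinite H.V
  have hadj : H.adj = H.edge.Adj := funext₂ fun _ _ => propext hH.adj_iff
  rw [Nat.card_eq_fintype_card] at hcard
  rw [Ham, hadj]
  refine ⟨hasTour_of_isHamiltonian (by omega), fun h => isHamiltonian_of_hasTour ?_ h⟩
  have : Nonempty H.V := h.1
  exact hcard.resolve_left Fintype.card_ne_zero

theorem two_mul_ncard_edgeSet {c : ℕ} (hH : H.NoArc) (hc : ∀ v, H.degree v = c) :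
    2 * H.edge.edgeSet.ncard = c * Nat.card H.V := by
  classical
  have := Fintype.ofFinite H.V
  have hdeg (v : H.V) : H.edge.degree v = c := by
    rw [← hc v, hH.degree_eq, ← Nat.card_coe_set_eq, Nat.card_eq_fintype_card,
      SimpleGraph.card_neighborSet_eq_degree]
  rw [← SimpleGraph.coe_edgeFinset, Set.ncard_coe_finset, ← H.edge.sum_degrees_eq_twice_card_edges,
    Nat.card_eq_fintype_card]
  simp only [hdeg, Finset.sum_const, Finset.card_univ, smul_eq_mul, mul_comm]

end MixedGraph.NoArc

namespace MixedGraph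

theorem total_ncard (M : MixedGraph) (R : M.V → M.V → Prop) :
    M.total (fun v => {u | R v u}.ncard) = {x : M.V × M.V | R x.1 x.2}.ncard := by
  classical
  have := Fintype.ofFinite M.V
  simp only [total_eq_sum, Set.ncard_eq_toFinset_card', Set.toFinset_ofPred, Finset.card_filter,
    Fintype.sum_prod_type]

theorem total_kdeg_out (M : MixedGraph) :
    M.total (M.kdeg .out) = {x : M.V × M.V | M.Arc x.1 x.2}.ncard :=
  total_ncard M M.Arc

theorem total_kdeg_inc (M : MixedGraph) :
    M.total (M.kdeg .inc) = {x : M.V × M.V | M.Arc x.1 x.2}.ncard := by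
  refine (total_ncard M (flip M.Arc)).trans ?_
  rw [← Set.ncard_image_of_injective _ Prod.swap_injective, Set.image_swap_eq_preimage_swap]
  rfl

end MixedGraph

namespace HCP

open MixedGraph

/-! ### The conversion -/

section Digraph

variable {V : Type} [Finite V] {G : Digraph V} {hG : ∀ v, ¬ G.Adj v v}

theorem ofDigraph_noUnd : (ofDigraph G hG).NoUnd := fun _ _ => id

theorem ofDigraph_ham_iff : (ofDigraph G hG).Ham ↔ HasDirectedHamiltonianCycle G := by
  have hadj : (ofDigraph G hG).adj = G.Adj := funext₂ fun _ _ => propext <| or_iff_left id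
  rw [Ham, hadj]
  exact hasTour_iff_exists_equiv_zmod

theorem numArcs_le_sumMaxDegree (G : Digraph V) (hG : ∀ v, ¬ G.Adj v v) :
    numArcs G ≤ sumMaxDegree G :=
  (total_kdeg_inc (ofDigraph G hG)).ge.trans (total_mono fun _ => le_max_left _ _)

theorem card_le_sumMaxDegree (h : ∀ v, 0 < (ofDigraph G hG).degree v) :
    Nat.card V ≤ sumMaxDegree G :=
  calc Nat.card V
    _ = (ofDigraph G hG).total fun _ => 1 := by rw [total_const, mul_one]; rfl
    _ ≤ sumMaxDegree G := total_mono fun v => by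
      have hv := h v
      rw [degree_eq_kdeg_add_kdeg_add_kdeg, ofDigraph_noUnd.kdeg_und] at hv
      change 1 ≤ max ((ofDigraph G hG).kdeg .inc v) ((ofDigraph G hG).kdeg .out v)
      omega

theorem splitSize_ofDigraph_le : splitSize (ofDigraph G hG) ≤ Nat.card V + 4 * numArcs G :=
  calc splitSize (ofDigraph G hG)
    _ ≤ (ofDigraph G hG).total fun v =>
        1 + 2 * ((ofDigraph G hG).kdeg .inc v + (ofDigraph G hG).kdeg .out v) :=
      total_mono fun v => by omega
    _ = Nat.card V * 1 + 2 * (numArcs G + numArcs G) := by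
      rw [total_add, total_const, total_mul, total_add, total_kdeg_inc, total_kdeg_out]
      rfl
    _ = Nat.card V + 4 * numArcs G := by ring

end Digraph

theorem numBad_le_card (d : ℕ) (M : MixedGraph) : numBad d M ≤ Nat.card M.V := by
  rw [← mul_one (Nat.card M.V), ← total_const]
  exact total_mono fun v => ite_le_one le_rfl zero_le_one

theorem exists_conversion {d : ℕ} (hd : 2 ≤ d) (M : MixedGraph) : ∃ H, Conversion d M H := by
  obtain ⟨A, hA⟩ := (splitStep_terminates hd).exists_runLoop M
  obtain ⟨B, hB⟩ := gateStep_terminates.exists_runLoop A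
  obtain ⟨D, hD⟩ := fourGateStep_terminates.exists_runLoop (karp B)
  by_cases h : ∃ v, D.degree v ≤ 1
  · exact ⟨petersen, A, B, D, hA, hB, hD, .inl ⟨h, rfl⟩⟩
  · obtain ⟨H, hH⟩ := diamondStep_terminates.exists_runLoop D
    exact ⟨H, A, B, D, hA, hB, hD, .inr ⟨h, hH⟩⟩

theorem degree_le_of_runLoop_splitStep {d : ℕ} (hd : 3 ≤ d) {M A : MixedGraph} (hM : M.NoUnd)
    (h : RunLoop (SplitStep d) M A) (v : A.V) : A.degree v ≤ 2 * d := by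
  have hA := (directedReduction_of_splitSteps h.1 hM).1
  have := kdeg_le_of_forall_not_splitStep hd h.2 v
  rw [degree_eq_kdeg_add_kdeg_add_kdeg, hA.kdeg_und]
  omega

theorem card_le_of_gateSteps_of_degree_le {M B : MixedGraph} {s : ℕ} (hM : ∀ v, M.degree v ≤ s)
    (h : ReflTransGen GateStep M B) : Nat.card B.V ≤ gateSize s * Nat.card M.V :=
  calc Nat.card B.V
    _ ≤ M.total fun v => gateSize (M.degree v) := card_le_of_gateSteps h
    _ ≤ M.total fun _ => gateSize s := total_mono fun v => gateSize_mono (hM v)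
    _ = gateSize s * Nat.card M.V := by rw [total_const, mul_comm]

theorem FourGateStep.three_le_card {M M' : MixedGraph} (h : FourGateStep M M') :
    3 ≤ Nat.card M'.V := by
  obtain ⟨v, p, -, -, rfl⟩ := h
  have := Nat.card_le_card_of_injective _ (inner_injective (v := v) (H := gate 4) (p := p))
  rw [Nat.card_eq_fintype_card, card_gate] at this
  omega

section Undirected

variable {B D : MixedGraph}

theorem noArc_of_fourGateSteps_karp (h : ReflTransGen FourGateStep (karp B) D) : D.NoArc :=
  invariant_of_reflTransGen h (karp_noArc B) fun _ _ hstep => hstep.noArc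

theorem card_eq_zero_or_three_le_of_fourGateSteps_karp (h : ReflTransGen FourGateStep (karp B) D) :
    Nat.card D.V = 0 ∨ 3 ≤ Nat.card D.V :=
  invariant_of_reflTransGen (P := fun X => Nat.card X.V = 0 ∨ 3 ≤ Nat.card X.V) h
    (by rw [card_karp]; omega) fun _ _ hstep _ => .inr hstep.three_le_card

theorem gateSteps_of_fourGateSteps (h : ReflTransGen FourGateStep B D) :
    ReflTransGen GateStep B D :=
  h.lift' id fun _ _ hstep => .single hstep.gateStep

theorem degree_karp_le_four (h : ∀ M', ¬ GateStep B M') (x : (karp B).V) :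
    (karp B).degree x ≤ 4 :=
  degree_karp_le (by decide) (degree_le_of_forall_not_gateStep h) x

end Undirected

namespace Conversion

variable {d : ℕ} {M H : MixedGraph}

theorem noArc (h : Conversion d M H) : H.NoArc := by
  obtain ⟨A, B, D, -, -, hD, hH⟩ := h
  exact hH.noArc (noArc_of_fourGateSteps_karp hD.1)

theorem degree_eq_three (h : Conversion d M H) (v : H.V) : H.degree v = 3 := by
  obtain ⟨A, B, D, -, hB, hD, hH⟩ := h
  exact hH.degree_eq_three
    (degree_le_three_of_runLoop_fourGateStep (degree_karp_le_four hB.2) hD) v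

theorem isUndirectedCubic (h : Conversion d M H) : IsUndirectedCubic H :=
  ⟨h.noArc, fun v => (h.noArc.degree_eq v).symm.trans (h.degree_eq_three v)⟩

theorem ham_iff (hM : M.NoUnd) (h : Conversion d M H) : H.Ham ↔ M.Ham := by
  obtain ⟨A, B, D, hA, hB, hD, hH⟩ := h
  calc H.Ham
    _ ↔ D.Ham := hH.ham_iff (noArc_of_fourGateSteps_karp hD.1)
      (card_eq_zero_or_three_le_of_fourGateSteps_karp hD.1)
    _ ↔ (karp B).Ham :=
      (reduction_of_gateSteps (gateSteps_of_fourGateSteps hD.1) (Nat.zero_le 3)).ham_iff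
    _ ↔ B.Ham := karp_ham_iff B
    _ ↔ A.Ham := (reduction_of_gateSteps hB.1 (Nat.zero_le 3)).ham_iff
    _ ↔ M.Ham := (directedReduction_of_splitSteps hA.1 hM).2.ham_iff

theorem hasHamiltonianCycle_iff (hM : M.NoUnd) (h : Conversion d M H) :
    HasHamiltonianCycle H ↔ M.Ham := by
  refine (h.noArc.hasHamiltonianCycle_iff ?_).trans (h.ham_iff hM)
  obtain hH | ⟨⟨v⟩⟩ := isEmpty_or_nonempty H.V
  · exact .inl Nat.card_of_isEmpty
  · exact .inr ((h.degree_eq_three v).ge.trans (h.noArc.degree_lt_card v).le)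

theorem card_le (hd : 3 ≤ d) (hM : M.NoUnd) (h : Conversion d M H) :
    Nat.card H.V ≤ 330 * gateSize (2 * d) * (splitSize M + numBad d M) := by
  obtain ⟨A, B, D, hA, hB, hD, hH⟩ := h
  have hDK : Nat.card D.V ≤ 11 * Nat.card (karp B).V :=
    card_le_of_gateSteps_of_degree_le (degree_karp_le_four hB.2) (gateSteps_of_fourGateSteps hD.1)
  calc Nat.card H.V
    _ ≤ 10 * Nat.card D.V := hH.card_le
    _ ≤ 10 * (11 * (3 * Nat.card B.V)) := Nat.mul_le_mul_left 10 (card_karp B ▸ hDK)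
    _ ≤ 10 * (11 * (3 * (gateSize (2 * d) * Nat.card A.V))) := by
      gcongr
      exact card_le_of_gateSteps_of_degree_le (degree_le_of_runLoop_splitStep hd hM hA) hB.1
    _ ≤ 10 * (11 * (3 * (gateSize (2 * d) * (splitSize M + numBad d M)))) := by
      gcongr
      exact card_le_splitSize_add_numBad hd hA.1
    _ = 330 * gateSize (2 * d) * (splitSize M + numBad d M) := by ring

theorem card_le_ten (hM : M.NoUnd) (hv : ∃ v, M.degree v ≤ 0) (h : Conversion d M H) :
    Nat.card H.V ≤ 10 := by
  obtain ⟨A, B, D, hA, hB, hD, hH⟩ := h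
  have hvA : ∃ v, A.degree v ≤ 0 := (directedReduction_of_splitSteps hA.1 hM).2.exists_degree_le hv
  obtain ⟨v, hvB⟩ : ∃ v, B.degree v ≤ 0 :=
    (reduction_of_gateSteps hB.1 (Nat.zero_le 3)).exists_degree_le hvA
  have hvK : (karp B).degree (karpVertex v 0) ≤ 1 :=
    (degree_karpVertex_zero_le v).trans (Nat.succ_le_succ hvB)
  exact hH.card_le_ten <|
    (reduction_of_gateSteps (gateSteps_of_fourGateSteps hD.1) (by decide)).exists_degree_le ⟨_, hvK⟩

section Digraph

variable {V : Type} [Finite V] {G : Digraph V} {hG : ∀ v, ¬ G.Adj v v}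

theorem card_le_card_add_numArcs (hd : 3 ≤ d) (h : Conversion d (ofDigraph G hG) H) :
    Nat.card H.V ≤ 1320 * gateSize (2 * d) * (Nat.card V + numArcs G) := by
  have hsize : splitSize (ofDigraph G hG) + numBad d (ofDigraph G hG) ≤
      4 * (Nat.card V + numArcs G) := by
    have hsplit : splitSize (ofDigraph G hG) ≤ _ := splitSize_ofDigraph_le
    have hbad : numBad d (ofDigraph G hG) ≤ Nat.card V := numBad_le_card ..
    omega
  calc Nat.card H.V
    _ ≤ 330 * gateSize (2 * d) * (splitSize (ofDigraph G hG) + numBad d (ofDigraph G hG)) :=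
      h.card_le hd ofDigraph_noUnd
    _ ≤ 330 * gateSize (2 * d) * (4 * (Nat.card V + numArcs G)) := Nat.mul_le_mul_left _ hsize
    _ = 1320 * gateSize (2 * d) * (Nat.card V + numArcs G) := by ring

theorem card_le_sumMaxDegree (hd : 3 ≤ d) (hk : 0 < sumMaxDegree G)
    (h : Conversion d (ofDigraph G hG) H) :
    Nat.card H.V ≤ 2640 * gateSize (2 * d) * sumMaxDegree G := by
  by_cases hv : ∃ v, (ofDigraph G hG).degree v ≤ 0
  · have hgate : 0 < gateSize (2 * d) := Nat.add_pos_left one_pos _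
    have hpos : 0 < gateSize (2 * d) * sumMaxDegree G := Nat.mul_pos hgate hk
    have := h.card_le_ten ofDigraph_noUnd hv
    rw [mul_assoc]
    omega
  · simp only [not_exists, not_le] at hv
    have hcard := HCP.card_le_sumMaxDegree hv
    have harcs := numArcs_le_sumMaxDegree G hG
    calc Nat.card H.V
      _ ≤ 1320 * gateSize (2 * d) * (Nat.card V + numArcs G) := h.card_le_card_add_numArcs hd
      _ ≤ 1320 * gateSize (2 * d) * (2 * sumMaxDegree G) := Nat.mul_le_mul_left _ (by omega)
      _ = 2640 * gateSize (2 * d) * sumMaxDegree G := by ring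

end Digraph

end Conversion

end HCP

theorem mainTheorem1_general (d : ℕ) (hd : 3 ≤ d) :
    (LoopTerminates (HCP.InSplitStep d) ∧ LoopTerminates (HCP.OutSplitStep d) ∧
      LoopTerminates (HCP.SplitStep d) ∧ LoopTerminates HCP.GateStep ∧
      LoopTerminates HCP.FourGateStep ∧ LoopTerminates HCP.DiamondStep) ∧
    ∃ C : ℕ, ∀ (V : Type) [Finite V] (G : Digraph V) (hG : ∀ v, ¬ G.Adj v v),
      (∃ H, HCP.Conversion d (MixedGraph.ofDigraph G hG) H) ∧
      ∀ H, HCP.Conversion d (MixedGraph.ofDigraph G hG) H →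
        HCP.IsUndirectedCubic H ∧
        (HCP.HasHamiltonianCycle H ↔ HasDirectedHamiltonianCycle G) ∧
        (0 < sumMaxDegree G →
          Nat.card H.V ≤ C * sumMaxDegree G ∧ H.edge.edgeSet.ncard ≤ C * sumMaxDegree G) ∧
        Nat.card H.V + H.edge.edgeSet.ncard ≤ C * (Nat.card V + numArcs G) := by
  refine ⟨⟨HCP.inSplitStep_terminates hd, HCP.outSplitStep_terminates hd,
    HCP.splitStep_terminates (by omega), HCP.gateStep_terminates, HCP.fourGateStep_terminates,
    HCP.diamondStep_terminates⟩, 3960 * HCP.gateSize (2 * d), fun V _ G hG =>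
    ⟨HCP.exists_conversion (by omega) _, fun H hH => ⟨hH.isUndirectedCubic,
      (hH.hasHamiltonianCycle_iff HCP.ofDigraph_noUnd).trans HCP.ofDigraph_ham_iff, ?_⟩⟩⟩
  have hedges := hH.noArc.two_mul_ncard_edgeSet hH.degree_eq_three
  have hsize := hH.card_le_card_add_numArcs hd
  rw [mul_assoc] at hsize ⊢
  rw [mul_assoc]
  refine ⟨fun hk => ?_, by omega⟩
  have hsize := hH.card_le_sumMaxDegree hd hk
  rw [mul_assoc] at hsize
  exact ⟨by omega, by omega⟩

theorem mainTheorem1 (d : ℕ) (hd : 4 ≤ d) :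
    -- none of the loops of the procedure can run forever
    (LoopTerminates (HCP.InSplitStep d) ∧ LoopTerminates (HCP.OutSplitStep d) ∧
      LoopTerminates (HCP.SplitStep d) ∧ LoopTerminates HCP.GateStep ∧
      LoopTerminates HCP.FourGateStep ∧ LoopTerminates HCP.DiamondStep) ∧
    ∃ C : ℕ, ∀ (V : Type) [Finite V] (G : Digraph V) (hG : ∀ v, ¬ G.Adj v v),
      -- the procedure has an outcome
      (∃ H, HCP.Conversion d (MixedGraph.ofDigraph G hG) H) ∧
      -- every outcome is an equivalent undirected cubic instance of linear size
      ∀ H, HCP.Conversion d (MixedGraph.ofDigraph G hG) H →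
        HCP.IsUndirectedCubic H ∧
        (HCP.HasHamiltonianCycle H ↔ HasDirectedHamiltonianCycle G) ∧
        (0 < sumMaxDegree G →
          Nat.card H.V ≤ C * sumMaxDegree G ∧ H.edge.edgeSet.ncard ≤ C * sumMaxDegree G) ∧
        Nat.card H.V + H.edge.edgeSet.ncard ≤ C * (Nat.card V + numArcs G) :=
  mainTheorem1_general d (by omega)
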